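/- Let $UVB_n$ be the unrestricted virtual braid group on $n$ strands, i.e. the group with generators $\sigma_1,\dots,\sigma_{n-1},\rho_1,\dots,\rho_{n-1}$ and the following defining relations, where $1\le i\le n-2$ in the relations that involve the index $i+1$: $$\sigma_i\sigma_{i+1}\sigma_i=\sigma_{i+1}\sigma_i\sigma_{i+1},\quad \sigma_i\sigma_j=\sigma_j\sigma_i\ (|i-j|\ge 2),$$ $$\rho_i\rho_{i+1}\rho_i=\rho_{i+1}\rho_i\rho_{i+1},\quad \rho_i\rho_j=\rho_j\rho_i\ (|i-j|\ge 2),\quad \rho_i^2=1,$$ $$\sigma_i\rho_j=\rho_j\sigma_i\ (|i-j|\ge 2),\quad \rho_i\rho_{i+1}\sigma_i=\sigma_{i+1}\rho_i\rho_{i+1},$$ $$\rho_i\sigma_{i+1}\sigma_i=\sigma_{i+1}\sigma_i\rho_{i+1},\quad \rho_{i+1}\sigma_i\sigma_{i+1}=\sigma_i\sigma_{i+1}\rho_i .$$ Let $UVP_n$ be the kernel of the homomorphism $UVB_n\to S_n$ that sends $\sigma_i$ and $\rho_i$ to the transposition $(i\ \,i+1)$, let $UVP_n'$ be its commutator subgroup,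 and identify $S_n$ with the subgroup of $UVB_n$ generated by $\rho_1,\dots,\rho_{n-1}$. An (oriented) fused link is a class of oriented link diagrams in the plane with classical and virtual crossings (generic immersions of finitely many oriented circles, each double point being marked as virtual or as classical with over/under information) up to planar isotopy and the classical, virtual and mixed Reidemeister moves and both forbidden moves. The closure $\widehat\alpha$ of $\alpha\in UVB_n$ is the fused link obtained from any word that represents $\alpha$ by drawing $\sigma_i^{\pm1}$ as classical crossings and $\rho_i^{\pm1}$ as virtual crossings of the strands $i$ and $i+1$ and closing the braid in the standard way. Let $\alpha,\beta\in UVP_n$. Suppose that there are representatives $a\in\alpha\,UVP_n'$ and $b\in\beta\,UVP_n'$ of the classes of $\alpha$ and $\beta$ in the abelianization $UVP_n/UVP_n'$ and an element $\mu\in S_n$ such that $b=\mu^{-1}a\mu$. Then the fused links $\widehat\alpha$ and $\widehat\beta$ are equivalent. -/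

import Mathlib

namespace FusedLinks

/-! ### The unrestricted virtual braid group -/

/-- The generators `σ_i` and `ρ_i` of the braid groups on `n` strands. The strands are numbered
`0, …, n - 1`, and the generators with index `i` involve the strands `i` and `i + 1`. -/
inductive Gen (n : ℕ) : Type
  | sigma (i : Fin (n - 1)) : Gen n
  | rho (i : Fin (n - 1)) : Gen n

/-- The free generator `σ_i`. -/
def fσ {n : ℕ} (i : Fin (n - 1)) : FreeGroup (Gen n) := FreeGroup.of (Gen.sigma i)

/-- The free generator `ρ_i`. -/
def fρ {n : ℕ} (i : Fin (n - 1)) : FreeGroup (Gen n) := FreeGroup.of (Gen.rho i)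

/-- The condition `|i - j| ≥ 2`. -/
def Far {m : ℕ} (i j : Fin m) : Prop := (i : ℕ) + 2 ≤ j ∨ (j : ℕ) + 2 ≤ i

/-- The defining relations `x = y` of `UVB_n`; in the relations on three strands, `j = i + 1`. -/
inductive Rel (n : ℕ) : FreeGroup (Gen n) → FreeGroup (Gen n) → Prop
  | B1 (i j : Fin (n - 1)) (h : (j : ℕ) = i + 1) : Rel n (fσ i * fσ j * fσ i) (fσ j * fσ i * fσ j)
  | B2 (i j : Fin (n - 1)) (h : Far i j) : Rel n (fσ i * fσ j) (fσ j * fσ i)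
  | P1 (i j : Fin (n - 1)) (h : (j : ℕ) = i + 1) : Rel n (fρ i * fρ j * fρ i) (fρ j * fρ i * fρ j)
  | P2 (i j : Fin (n - 1)) (h : Far i j) : Rel n (fρ i * fρ j) (fρ j * fρ i)
  | P3 (i : Fin (n - 1)) : Rel n (fρ i * fρ i) 1
  | M1 (i j : Fin (n - 1)) (h : Far i j) : Rel n (fσ i * fρ j) (fρ j * fσ i)
  | M2 (i j : Fin (n - 1)) (h : (j : ℕ) = i + 1) : Rel n (fρ i * fρ j * fσ i) (fσ j * fρ i * fρ j)
  | F1 (i j : Fin (n - 1)) (h : (j : ℕ) = i + 1) : Rel n (fρ i * fσ j * fσ i) (fσ j * fσ i * fρ j)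
  | F2 (i j : Fin (n - 1)) (h : (j : ℕ) = i + 1) : Rel n (fρ j * fσ i * fσ j) (fσ i * fσ j * fρ i)

/-- The relators of `UVB_n`. -/
def relators (n : ℕ) : Set (FreeGroup (Gen n)) := {r | ∃ x y, Rel n x y ∧ r = x * y⁻¹}

/-- The unrestricted virtual braid group `UVB_n`. -/
abbrev UVB (n : ℕ) : Type := PresentedGroup (relators n)

/-- The transposition `τ_i = (i, i + 1)`. -/
def tau {n : ℕ} (i : Fin (n - 1)) : Equiv.Perm (Fin n) :=
  Equiv.swap ⟨i, by omega⟩ ⟨(i : ℕ) + 1, by omega⟩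

/-- Both `σ_i` and `ρ_i` induce the transposition `τ_i`. -/
def genPerm {n : ℕ} : Gen n → Equiv.Perm (Fin n)
  | .sigma i => tau i
  | .rho i => tau i

theorem swap_braid {X : Type*} [DecidableEq X] (x y z : X) (h1 : x ≠ y) (h2 : x ≠ z) (h3 : y ≠ z) :
    Equiv.swap x y * Equiv.swap y z * Equiv.swap x y =
      Equiv.swap y z * Equiv.swap x y * Equiv.swap y z := by
  rw [Equiv.swap_mul_swap_mul_swap h1 h2, Equiv.swap_comm x y, Equiv.swap_comm y z,
    Equiv.swap_mul_swap_mul_swap h3.symm h2.symm, Equiv.swap_comm]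

theorem tau_braid {n : ℕ} (i j : Fin (n - 1)) (h : (j : ℕ) = i + 1) :
    tau i * tau j * tau i = tau j * tau i * tau j := by
  obtain ⟨i, hi⟩ := i
  obtain ⟨j, hj⟩ := j
  simp only at h
  subst h
  refine swap_braid _ _ _ ?_ ?_ ?_ <;> simp only [ne_eq, Fin.mk.injEq] <;> omega

theorem tau_comm {n : ℕ} (i j : Fin (n - 1)) (h : Far i j) : tau i * tau j = tau j * tau i := by
  unfold Far at h
  refine Equiv.Perm.Disjoint.commute fun x => ?_
  simp only [tau, Equiv.swap_apply_def, Fin.ext_iff]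
  by_cases h1 : (x : ℕ) = i <;> by_cases h2 : (x : ℕ) = i + 1
  · omega
  · right; rw [if_neg (by omega), if_neg (by omega)]
  · right; rw [if_neg (by omega), if_neg (by omega)]
  · left; rw [if_neg h1, if_neg h2]

theorem genPerm_relators {n : ℕ} : ∀ r ∈ relators n, FreeGroup.lift genPerm r = 1 := by
  rintro r ⟨x, y, h, rfl⟩
  rw [map_mul, map_inv, mul_inv_eq_one]
  cases h <;> simp only [fσ, fρ, map_mul, map_one, FreeGroup.lift_apply_of, genPerm]
  case P3 i => exact Equiv.swap_mul_self _ _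
  case F2 i j h => exact (tau_braid i j h).symm
  all_goals first | exact tau_comm _ _ ‹_› | exact tau_braid _ _ ‹_›

/-- The homomorphism `ι : UVB_n → S_n` with `σ_i, ρ_i ↦ τ_i`. -/
def iota (n : ℕ) : UVB n →* Equiv.Perm (Fin n) :=
  PresentedGroup.toGroup (f := genPerm) genPerm_relators

/-- The pure unrestricted virtual braid group `UVP_n`. -/
def UVP (n : ℕ) : Subgroup (UVB n) := (iota n).ker

/-- The copy of the symmetric group `S_n` in `UVB_n`, generated by `ρ_1, …, ρ_{n-1}`. -/
def symmSubgroup (n : ℕ) : Subgroup (UVB n) :=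
  Subgroup.closure (Set.range fun i : Fin (n - 1) => (PresentedGroup.of (Gen.rho i) : UVB n))

/-! ### Fused link diagrams

An oriented link diagram in the plane in general position with respect to a height function is cut
by horizontal lines into slices, each of which consists of vertical strands and of one elementary
piece: a cup, a cap or a crossing. It is recorded by the list of its slices, read
along the height function. Between two slices the diagram meets a horizontal line in finitely many
points; they are recorded, from left to right, by the list of the directions of the strands
(`true`: in the reading direction, `false`: against it). -/

/-- The kinds of crossings of two strands, one of which goes from left to right and the other
from right to left in the reading direction: classical with the first of these strands above,
classical with the second one above, and virtual. -/
inductive Kind : Type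
  | lr
  | rl
  | virt

/-- The kind of the crossing in which the two strands exchange their roles: the strand
that went from left to right now goes from right to left, and what is above remains above. -/
def Kind.swap : Kind → Kind
  | .lr => .rl
  | .rl => .lr
  | .virt => .virt

/-- The elementary pieces: `cup d` is an arc that begins two strands, the left one of direction
`d`; `cap` is an arc that ends two strands; `cross k` is a crossing of two strands. -/
inductive Piece : Type
  | cup (d : Bool)
  | cap
  | cross (k : Kind)

/-- The number of strands that enter a piece. -/
def Piece.ins : Piece → ℕ
  | .cup _ => 0
  | .cap => 2
  | .cross _ => 2

/-- The number of strands that leave a piece. -/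
def Piece.outs : Piece → ℕ
  | .cup _ => 2
  | .cap => 0
  | .cross _ => 2

/-- A slice: an elementary piece with `pos` vertical strands to the left of it. -/
structure Slice : Type where
  piece : Piece
  pos : ℕ

/-- The directions of the strands before and after a piece. -/
inductive Piece.Acts : Piece → List Bool → List Bool → Prop
  | cup (d : Bool) : Acts (.cup d) [] [d, !d]
  | cap (d : Bool) : Acts .cap [d, !d] []
  | cross (k : Kind) (x y : Bool) : Acts (.cross k) [x, y] [y, x]

/-- `Runs w S T`: the slices in `w` fit together to an oriented tangle diagram that begins with
strands of the directions `S` and ends with strands of the directions `T`. -/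
inductive Runs : List Slice → List Bool → List Bool → Prop
  | nil (S : List Bool) : Runs [] S S
  | cons {p : Piece} {X Y : List Bool} (h : p.Acts X Y) (L R : List Bool) {w : List Slice}
      {T : List Bool} (hw : Runs w (L ++ Y ++ R) T) :
      Runs (⟨p, L.length⟩ :: w) (L ++ X ++ R) T

/-- An oriented fused link diagram. -/
structure Diagram : Type where
  word : List Slice
  closed : Runs word [] []

/-- The triangle moves of three strands `x, y, z`, in this order from left to right, where `a`,
`b`, `c` are the kinds of the crossings of `x` with `y`, of `x` with `z` and of `y` with `z`:
one of the strands (`x`, `z`, `y` respectively) lies above both others, lies below both others, or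
crosses both others virtually, and is moved across the crossing of these. If the
strand is above or below, this is the classical third Reidemeister move or, if the other two
strands cross virtually, one of the two forbidden moves. If it is virtual, this is the third
virtual move or, if the other two strands cross classically, the mixed move. -/
def Kind.Triangle (a b c : Kind) : Prop := a = b ∨ b = c ∨ c = a.swap

/-- The local moves. The first five generate the isotopies of the plane; the others are
the classical, virtual, mixed and forbidden Reidemeister moves (with `k` classical or virtual). -/
inductive Move : List Slice → List Slice → Prop
  | exchange (s t : Piece) (i d : ℕ) :
      Move [⟨s, i⟩, ⟨t, i + s.outs + d⟩] [⟨t, i + s.ins + d⟩, ⟨s, i⟩]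
  | zigzag_left (d : Bool) (i : ℕ) : Move [⟨.cup d, i + 1⟩, ⟨.cap, i⟩] []
  | zigzag_right (d : Bool) (i : ℕ) : Move [⟨.cup d, i⟩, ⟨.cap, i + 1⟩] []
  | slide_cup (d : Bool) (k : Kind) (i : ℕ) :
      Move [⟨.cup d, i⟩, ⟨.cross k, i + 1⟩] [⟨.cup d, i + 1⟩, ⟨.cross k.swap, i⟩]
  | slide_cap (k : Kind) (i : ℕ) :
      Move [⟨.cross k, i⟩, ⟨.cap, i + 1⟩] [⟨.cross k.swap, i + 1⟩, ⟨.cap, i⟩]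
  | R1_cup (d : Bool) (k : Kind) (i : ℕ) : Move [⟨.cup d, i⟩, ⟨.cross k, i⟩] [⟨.cup (!d), i⟩]
  | R1_cap (k : Kind) (i : ℕ) : Move [⟨.cross k, i⟩, ⟨.cap, i⟩] [⟨.cap, i⟩]
  | R2 (k : Kind) (i : ℕ) : Move [⟨.cross k, i⟩, ⟨.cross k.swap, i⟩] []
  | R3 (a b c : Kind) (h : a.Triangle b c) (i : ℕ) :
      Move [⟨.cross a, i⟩, ⟨.cross b, i + 1⟩, ⟨.cross c, i⟩]
        [⟨.cross c, i + 1⟩, ⟨.cross b, i⟩, ⟨.cross a, i + 1⟩]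

/-- Two diagrams are related by one local move. -/
def Diagram.Step (D E : Diagram) : Prop :=
  ∃ P Q U V : List Slice, Move U V ∧ D.word = P ++ U ++ Q ∧ E.word = P ++ V ++ Q

/-- Two diagrams represent equivalent fused links. -/
def Diagram.Equivalent (D E : Diagram) : Prop := Relation.EqvGen Diagram.Step D E

/-! ### Closures of braids -/

/-- A word in the letters `σ_i^{±1}`, `ρ_i^{±1}`, with `true` for the exponent `1`. -/
abbrev BraidWord (n : ℕ) : Type := List (Gen n × Bool)

/-- The element of `UVB_n` that is represented by a word. -/
def BraidWord.toUVB {n : ℕ} (w : BraidWord n) : UVB n :=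
  PresentedGroup.mk (relators n) (FreeGroup.mk w)

/-- The crossing that represents a letter. -/
def letterSlice {n : ℕ} : Gen n × Bool → Slice
  | (.sigma i, true) => ⟨.cross .lr, i⟩
  | (.sigma i, false) => ⟨.cross .rl, i⟩
  | (.rho i, _) => ⟨.cross .virt, i⟩

/-- The `n` nested cups that begin `n` strands and, to the right of these, `n` returning strands. -/
def cups (n : ℕ) : List Slice := (List.range n).map fun i => ⟨.cup true, i⟩

/-- The `n` nested caps that join `n` strands with `n` returning strands to the right of these. -/
def caps (n : ℕ) : List Slice := (List.range n).reverse.map fun i => ⟨.cap, i⟩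

theorem Runs.append {u v : List Slice} {S T W : List Bool} (hu : Runs u S T) (hv : Runs v T W) :
    Runs (u ++ v) S W := by
  induction hu with
  | nil S => exact hv
  | cons h L R hw ih => exact Runs.cons h L R (ih hv)

theorem runs_single {p : Piece} {X Y S T : List Bool} (h : p.Acts X Y) (L R : List Bool) {i : ℕ}
    (hi : L.length = i) (hS : L ++ X ++ R = S) (hT : L ++ Y ++ R = T) : Runs [⟨p, i⟩] S T := by
  subst hi hS hT
  exact Runs.cons h L R (Runs.nil _)

theorem runs_cups (n : ℕ) :
    Runs (cups n) [] (List.replicate n true ++ List.replicate n false) := by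
  induction n with
  | zero => exact Runs.nil []
  | succ n ih =>
    have h : cups (n + 1) = cups n ++ [⟨.cup true, n⟩] := by simp [cups, List.range_succ]
    rw [h]
    refine ih.append (runs_single (Piece.Acts.cup true) (List.replicate n true)
      (List.replicate n false) (by simp) (by simp) ?_)
    rw [List.replicate_succ' (a := true), List.replicate_succ (a := false)]
    simp

theorem runs_caps (n : ℕ) :
    Runs (caps n) (List.replicate n true ++ List.replicate n false) [] := by
  induction n with
  | zero => exact Runs.nil []
  | succ n ih =>
    have h : caps (n + 1) = [⟨.cap, n⟩] ++ caps n := by simp [caps, List.range_succ]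
    rw [h]
    refine (runs_single (Piece.Acts.cap true) (List.replicate n true)
      (List.replicate n false) (by simp) ?_ (by simp)).append ih
    rw [List.replicate_succ' (a := true), List.replicate_succ (a := false)]
    simp

theorem runs_letters {n : ℕ} (w : BraidWord n) (R : List Bool) :
    Runs (w.map letterSlice) (List.replicate n true ++ R) (List.replicate n true ++ R) := by
  induction w with
  | nil => exact Runs.nil _
  | cons x w ih =>
    have key : ∀ (k : Kind) (i : Fin (n - 1)),
        Runs [⟨.cross k, i⟩] (List.replicate n true ++ R) (List.replicate n true ++ R) := by
      intro k i
      have e : List.replicate (i : ℕ) true ++ [true, true] ++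
          (List.replicate (n - 2 - i) true ++ R) = List.replicate n true ++ R := by
        have h2 : [true, true] = List.replicate 2 true := rfl
        rw [h2, ← List.append_assoc, List.replicate_append_replicate,
          List.replicate_append_replicate]
        congr 2
        omega
      exact runs_single (Piece.Acts.cross k true true) _ _ (by simp) e e
    have hx : Runs [letterSlice x] (List.replicate n true ++ R) (List.replicate n true ++ R) := by
      rcases x with ⟨i | i, _ | _⟩ <;> exact key _ i
    exact hx.append ih

/-- The closure of a braid word: the braid, with all strands in the reading direction, whose ends
are joined to its beginnings by nested arcs to the right of it without further crossings. -/
def BraidWord.closure {n : ℕ} (w : BraidWord n) : Diagram where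
  word := cups n ++ w.map letterSlice ++ caps n
  closed := ((runs_cups n).append (runs_letters w _)).append (runs_caps n)

/-- `D` is a diagram of the closure of the braid `α`. -/
def IsClosure {n : ℕ} (α : UVB n) (D : Diagram) : Prop :=
  ∃ w : BraidWord n, w.toUVB = α ∧ D = w.closure

end FusedLinks

/-! The closure of a braid is unchanged by conjugation, so the point is that multiplying a pure
braid by an element of `UVP_n'` does not change its closure either. The group `UVP_n` is generated
by the conjugates `λ_ij` of `σ_0 ρ_0` by permutations. Two of them that share exactly one index
commute, by the forbidden relations together with the braid relation (`lam_commute_triangle`), and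
two with disjoint indices commute by the far relations (`lam_commute_disjoint`). Only `λ_ij` and
`λ_ji` may fail to commute, so a normal subgroup of `UVB_n` that contains all `[λ_ij, λ_ji]`
contains `UVP_n'`. The braids that can be inserted in any closure without changing it form a normal
subgroup (`closureKernel`), and it remains to exchange `λ_ij` and `λ_ji` inside a closure
(`closureEquiv_lam_exchange`).

A closure allows what the group does not: a strand can be cut and rerouted virtually through a new
strand (`closureEquiv_cut`). If strand `i` is cut between `λ_ij` and `λ_ji`, the factors become
`λ_ij` and `λ_ju` with `u` new, and these commute. Strand `j` is then cut as well, and both cuts are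
undone, with the factors in the opposite order.

These arguments rest on three facts about diagrams: equal braids have equivalent closures
(`closure_equivalent_of_toUVB_eq`), conjugation slides crossings along the cups and caps
(`closure_append_equivalent`), and a virtual stabilization can be removed (`closure_stabilization`).
On the algebraic side, `S_n` embeds in `UVB_n` (`eq_one_of_mem_symmSubgroup`), so that permutations
can be used as braids. -/

namespace FusedLinks

/-! ### Inversion of `Runs` -/

theorem Runs.of_append {u v : List Slice} {S W : List Bool} (h : Runs (u ++ v) S W) :
    ∃ T, Runs u S T ∧ Runs v T W := by
  induction u generalizing S with
  | nil => exact ⟨S, Runs.nil S, h⟩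
  | cons x u ih =>
    cases h with
    | cons hp L R hw =>
      obtain ⟨T, h1, h2⟩ := ih hw
      exact ⟨T, Runs.cons hp L R h1, h2⟩

theorem runs_nil_iff {S T : List Bool} : Runs [] S T ↔ S = T :=
  ⟨fun h => by cases h; rfl, fun h => h ▸ Runs.nil S⟩

theorem runs_cons_iff {p : Piece} {i : ℕ} {w : List Slice} {S T : List Bool} :
    Runs (⟨p, i⟩ :: w) S T ↔
      ∃ L X Y R, p.Acts X Y ∧ L.length = i ∧ S = L ++ X ++ R ∧ Runs w (L ++ Y ++ R) T := by
  constructor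
  · intro h
    cases h with
    | cons hp L R hw => exact ⟨L, _, _, R, hp, rfl, rfl, hw⟩
  · rintro ⟨L, X, Y, R, hp, rfl, rfl, hw⟩
    exact Runs.cons hp L R hw

theorem runs_cross_iff {k : Kind} {i : ℕ} {w : List Slice} {S T : List Bool} :
    Runs (⟨.cross k, i⟩ :: w) S T ↔
      ∃ L x y R, L.length = i ∧ S = L ++ x :: y :: R ∧ Runs w (L ++ y :: x :: R) T := by
  rw [runs_cons_iff]
  constructor
  · rintro ⟨L, _, _, R, ⟨⟩, hL, rfl, hw⟩
    exact ⟨L, _, _, R, hL, List.append_assoc _ _ _, by simpa using hw⟩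
  · rintro ⟨L, x, y, R, hL, rfl, hw⟩
    exact ⟨L, _, _, R, .cross k x y, hL, by simp, by simpa using hw⟩

theorem runs_cup_iff {d : Bool} {i : ℕ} {w : List Slice} {S T : List Bool} :
    Runs (⟨.cup d, i⟩ :: w) S T ↔
      ∃ L R, L.length = i ∧ S = L ++ R ∧ Runs w (L ++ d :: (!d) :: R) T := by
  rw [runs_cons_iff]
  constructor
  · rintro ⟨L, _, _, R, ⟨⟩, hL, rfl, hw⟩
    exact ⟨L, R, hL, by simp, by simpa using hw⟩
  · rintro ⟨L, R, hL, rfl, hw⟩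
    exact ⟨L, _, _, R, .cup d, hL, by simp, by simpa using hw⟩

theorem runs_cap_iff {i : ℕ} {w : List Slice} {S T : List Bool} :
    Runs (⟨.cap, i⟩ :: w) S T ↔
      ∃ L d R, L.length = i ∧ S = L ++ d :: (!d) :: R ∧ Runs w (L ++ R) T := by
  rw [runs_cons_iff]
  constructor
  · rintro ⟨L, _, _, R, ⟨⟩, hL, rfl, hw⟩
    exact ⟨L, _, R, hL, List.append_assoc _ _ _, by simpa using hw⟩
  · rintro ⟨L, d, R, hL, rfl, hw⟩
    exact ⟨L, _, _, R, .cap d, hL, by simp, by simpa using hw⟩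

theorem Piece.Acts.length_ins {p : Piece} {X Y : List Bool} (h : p.Acts X Y) :
    X.length = p.ins := by
  cases h <;> rfl

theorem Piece.Acts.length_outs {p : Piece} {X Y : List Bool} (h : p.Acts X Y) :
    Y.length = p.outs := by
  cases h <;> rfl

theorem append_cons_split {L L' R R' : List Bool} {a : Bool} (h : L ++ a :: R = L' ++ R')
    (hl : L'.length = L.length + 1) : L' = L ++ [a] ∧ R' = R := by
  have h' : (L ++ [a]) ++ R = L' ++ R' := by simpa using h
  obtain ⟨h1, h2⟩ := List.append_inj h' (by simp [hl])
  exact ⟨h1.symm, h2.symm⟩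

theorem append_split {L L' R R' : List Bool} (h : L ++ R = L' ++ R')
    (hl : L.length ≤ L'.length) : ∃ M, L' = L ++ M ∧ R = M ++ R' := by
  rcases List.append_eq_append_iff.1 h with ⟨M, h1, h2⟩ | ⟨M, h1, h2⟩
  · exact ⟨M, h1, h2⟩
  · subst h1
    have : M = [] := by
      rw [List.length_append] at hl
      exact List.length_eq_zero_iff.1 (by omega)
    subst this
    exact ⟨[], by simp, by simpa using h2.symm⟩

/-! ### Equivalence of tangle words -/

theorem Diagram.Equivalent.refl (D : Diagram) : D.Equivalent D := Relation.EqvGen.refl D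

theorem Diagram.Equivalent.symm {D E : Diagram} (h : D.Equivalent E) : E.Equivalent D :=
  Relation.EqvGen.symm _ _ h

theorem Diagram.Equivalent.trans {D E F : Diagram} (h : D.Equivalent E) (h' : E.Equivalent F) :
    D.Equivalent F :=
  Relation.EqvGen.trans _ _ _ h h'

/-- The words `u` and `v` describe tangles from `S` to `T`, and replacing one by the other in a
closed diagram yields an equivalent diagram. -/
structure TangleEquiv (S T : List Bool) (u v : List Slice) : Prop where
  runs_left : Runs u S T
  runs_right : Runs v S T
  equivalent : ∀ (P Q : List Slice) (D E : Diagram), Runs P [] S → Runs Q T [] →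
    D.word = P ++ u ++ Q → E.word = P ++ v ++ Q → D.Equivalent E

namespace TangleEquiv

variable {S T W : List Bool} {u v w u' v' : List Slice}

theorem refl (h : Runs u S T) : TangleEquiv S T u u where
  runs_left := h
  runs_right := h
  equivalent := by
    rintro P Q ⟨D, hD⟩ ⟨E, hE⟩ - - rfl rfl
    exact Diagram.Equivalent.refl _

theorem symm (h : TangleEquiv S T u v) : TangleEquiv S T v u where
  runs_left := h.runs_right
  runs_right := h.runs_left
  equivalent P Q D E hP hQ hD hE := (h.equivalent P Q E D hP hQ hE hD).symm

/-- The boundary data serve here: the intermediate diagram with `v` inserted must be closed, and it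
is because `v` runs from `S` to `T`. -/
theorem trans (h : TangleEquiv S T u v) (h' : TangleEquiv S T v w) : TangleEquiv S T u w where
  runs_left := h.runs_left
  runs_right := h'.runs_right
  equivalent P Q D E hP hQ hD hE :=
    (h.equivalent P Q D ⟨_, (hP.append h.runs_right).append hQ⟩ hP hQ hD rfl).trans
      (h'.equivalent P Q _ E hP hQ rfl hE)

theorem append_right (h : TangleEquiv S T u v) (hw : Runs w T W) :
    TangleEquiv S W (u ++ w) (v ++ w) where
  runs_left := h.runs_left.append hw
  runs_right := h.runs_right.append hw
  equivalent P Q D E hP hQ hD hE :=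
    h.equivalent P (w ++ Q) D E hP (hw.append hQ) (by simp [hD]) (by simp [hE])

theorem append_left (hw : Runs w W S) (h : TangleEquiv S T u v) :
    TangleEquiv W T (w ++ u) (w ++ v) where
  runs_left := hw.append h.runs_left
  runs_right := hw.append h.runs_right
  equivalent P Q D E hP hQ hD hE :=
    h.equivalent (P ++ w) Q D E (hP.append hw) hQ (by simp [hD]) (by simp [hE])

theorem append (h : TangleEquiv S T u v) (h' : TangleEquiv T W u' v') :
    TangleEquiv S W (u ++ u') (v ++ v') :=
  (h.append_right h'.runs_left).trans (append_left h.runs_right h')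

theorem of_move (h : Move u v) (hu : Runs u S T) (hv : Runs v S T) : TangleEquiv S T u v where
  runs_left := hu
  runs_right := hv
  equivalent P Q _ _ _ _ hD hE := Relation.EqvGen.rel _ _ ⟨P, Q, u, v, h, hD, hE⟩

theorem closed {D E : Diagram} (h : TangleEquiv [] [] D.word E.word) : D.Equivalent E :=
  h.equivalent [] [] D E (Runs.nil _) (Runs.nil _) (by simp) (by simp)

end TangleEquiv

/-- Wherever the word `u` describes a tangle, it may be replaced by `v`. -/
def Red (u v : List Slice) : Prop := ∀ S T, Runs u S T → TangleEquiv S T u v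

namespace Red

variable {u v w u' v' : List Slice}

theorem refl (u : List Slice) : Red u u := fun _ _ h => TangleEquiv.refl h

theorem trans (h : Red u v) (h' : Red v w) : Red u w :=
  fun S T hu => (h S T hu).trans (h' S T (h S T hu).runs_right)

theorem append (h : Red u v) (h' : Red u' v') : Red (u ++ u') (v ++ v') := by
  intro S W hu
  obtain ⟨T, h1, h2⟩ := hu.of_append
  exact (h S T h1).append (h' T W h2)

theorem append_right (h : Red u v) (w : List Slice) : Red (u ++ w) (v ++ w) := h.append (refl w)

theorem append_left (w : List Slice) (h : Red u v) : Red (w ++ u) (w ++ v) := (refl w).append h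

/-- `Red` is directed because moves do not record boundaries: the empty word runs on every boundary,
while two crossings that cancel need two strands at their position. Each direction of a move
therefore needs its own check that the boundary is inherited. -/
theorem of_move (h : Move u v) (hr : ∀ S T, Runs u S T → Runs v S T) : Red u v :=
  fun S T hu => TangleEquiv.of_move h hu (hr S T hu)

theorem of_move_symm (h : Move u v) (hr : ∀ S T, Runs v S T → Runs u S T) : Red v u :=
  fun S T hv => (TangleEquiv.of_move h (hr S T hv) hv).symm

theorem closed {D E : Diagram} (h : Red D.word E.word) : D.Equivalent E :=
  (h [] [] D.closed).closed

theorem exchange (s t : Piece) (i d : ℕ) :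
    Red [⟨s, i⟩, ⟨t, i + s.outs + d⟩] [⟨t, i + s.ins + d⟩, ⟨s, i⟩] := by
  refine of_move (.exchange s t i d) fun S T h => ?_
  simp only [runs_cons_iff, runs_nil_iff] at h
  obtain ⟨L, X, Y, R, hs, rfl, rfl, L', X', Y', R', ht, hl, he, rfl⟩ := h
  rw [List.append_assoc L'] at he
  -- `M` is the block of vertical strands between the two pieces.
  obtain ⟨M, rfl, rfl⟩ := append_split he (by rw [hl, List.length_append, hs.length_outs]; omega)
  simp only [List.length_append, hs.length_outs] at hl
  have h1 : Runs [⟨s, L.length⟩] (L ++ X ++ (M ++ Y' ++ R')) (L ++ Y ++ (M ++ Y' ++ R')) :=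
    runs_single hs _ _ rfl rfl rfl
  refine (runs_single ht (L ++ X ++ M) R' ?_ ?_ rfl).append (v := [⟨s, L.length⟩]) ?_
  · simp only [List.length_append, hs.length_ins]; omega
  · simp
  · simpa using h1

theorem exchange_symm (s t : Piece) (i d : ℕ) :
    Red [⟨t, i + s.ins + d⟩, ⟨s, i⟩] [⟨s, i⟩, ⟨t, i + s.outs + d⟩] := by
  refine of_move_symm (.exchange s t i d) fun S T h => ?_
  simp only [runs_cons_iff, runs_nil_iff] at h
  obtain ⟨L', X', Y', R', ht, hl, rfl, L, X, Y, R, hs, rfl, he, rfl⟩ := h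
  rw [List.append_assoc L'] at he
  obtain ⟨M, rfl, rfl⟩ := append_split he.symm
    (by rw [hl, List.length_append, hs.length_ins]; omega)
  simp only [List.length_append, hs.length_ins] at hl
  have h1 : Runs [⟨s, L.length⟩] (L ++ X ++ (M ++ X' ++ R')) (L ++ Y ++ (M ++ X' ++ R')) :=
    runs_single hs _ _ rfl rfl rfl
  have h2 := h1.append (v := [⟨t, L.length + s.outs + d⟩])
    (runs_single ht (L ++ Y ++ M) R' (T := L ++ Y ++ (M ++ (Y' ++ R'))) ?_ ?_ ?_)
  · simpa using h2
  · simp only [List.length_append, hs.length_outs]; omega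
  · simp
  · simp

theorem R2 (k : Kind) (i : ℕ) : Red [⟨.cross k, i⟩, ⟨.cross k.swap, i⟩] [] := by
  refine of_move (.R2 k i) fun S T h => ?_
  simp only [runs_cross_iff, runs_nil_iff] at h ⊢
  obtain ⟨L, x, y, R, rfl, rfl, L', x', y', R', hl, he, rfl⟩ := h
  obtain ⟨rfl, h2⟩ := List.append_inj he hl.symm
  simp only [List.cons.injEq] at h2
  obtain ⟨rfl, rfl, rfl⟩ := h2
  rfl

theorem R3 {a b c : Kind} (h : a.Triangle b c) (i : ℕ) :
    Red [⟨.cross a, i⟩, ⟨.cross b, i + 1⟩, ⟨.cross c, i⟩]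
      [⟨.cross c, i + 1⟩, ⟨.cross b, i⟩, ⟨.cross a, i + 1⟩] := by
  refine of_move (.R3 a b c h i) fun S T h => ?_
  simp only [runs_cross_iff, runs_nil_iff] at h
  obtain ⟨L, x, y, R, rfl, rfl, L', x', y', R', hl, he, L'', x'', y'', R'', hl', he', rfl⟩ := h
  obtain ⟨rfl, h2⟩ := append_cons_split he hl
  simp only [List.cons.injEq] at h2
  obtain ⟨rfl, rfl⟩ := h2
  rw [List.append_assoc] at he'
  obtain ⟨rfl, h2⟩ := List.append_inj he' hl'.symm
  simp only [List.cons_append, List.nil_append, List.cons.injEq] at h2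
  obtain ⟨rfl, rfl, rfl⟩ := h2
  simp only [runs_cross_iff, runs_nil_iff]
  exact ⟨L ++ [x'], y, y', R', by simp, by simp, L, x', y', y :: R', rfl, by simp,
    L ++ [y'], x', y, R', by simp, by simp, by simp⟩

theorem zigzag_left (d : Bool) (i : ℕ) : Red [⟨.cup d, i + 1⟩, ⟨.cap, i⟩] [] := by
  refine of_move (.zigzag_left d i) fun S T h => ?_
  simp only [runs_cup_iff, runs_cap_iff, runs_nil_iff] at h ⊢
  obtain ⟨L, R, hl, rfl, L', e, R', rfl, he, rfl⟩ := h
  obtain ⟨rfl, h2⟩ := append_cons_split he.symm hl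
  simp only [List.cons.injEq] at h2
  obtain ⟨rfl, rfl⟩ := h2
  simp

theorem R1_cup (d : Bool) (k : Kind) (i : ℕ) :
    Red [⟨.cup d, i⟩, ⟨.cross k, i⟩] [⟨.cup (!d), i⟩] := by
  refine of_move (.R1_cup d k i) fun S T h => ?_
  simp only [runs_cup_iff, runs_cross_iff, runs_nil_iff] at h ⊢
  obtain ⟨L, R, rfl, rfl, L', x, y, R', hl, he, rfl⟩ := h
  obtain ⟨rfl, h2⟩ := List.append_inj he hl.symm
  simp only [List.cons.injEq] at h2
  obtain ⟨rfl, rfl, rfl⟩ := h2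
  exact ⟨L, R, rfl, rfl, by simp⟩

theorem slide_cup_symm (d : Bool) (k : Kind) (i : ℕ) :
    Red [⟨.cup d, i + 1⟩, ⟨.cross k.swap, i⟩] [⟨.cup d, i⟩, ⟨.cross k, i + 1⟩] := by
  refine of_move_symm (.slide_cup d k i) fun S T h => ?_
  simp only [runs_cup_iff, runs_cross_iff, runs_nil_iff] at h ⊢
  obtain ⟨L, R, hl, rfl, L', x, y, R', rfl, he, rfl⟩ := h
  obtain ⟨rfl, h2⟩ := append_cons_split he.symm hl
  simp only [List.cons.injEq] at h2
  obtain ⟨rfl, rfl⟩ := h2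
  exact ⟨L', x :: R, rfl, by simp, L' ++ [d], !d, x, R, by simp, by simp, by simp⟩

theorem slide_cap (k : Kind) (i : ℕ) :
    Red [⟨.cross k, i⟩, ⟨.cap, i + 1⟩] [⟨.cross k.swap, i + 1⟩, ⟨.cap, i⟩] := by
  refine of_move (.slide_cap k i) fun S T h => ?_
  simp only [runs_cap_iff, runs_cross_iff, runs_nil_iff] at h ⊢
  obtain ⟨L, x, y, R, rfl, rfl, L', d, R', hl, he, rfl⟩ := h
  obtain ⟨rfl, h2⟩ := append_cons_split he hl
  simp only [List.cons.injEq] at h2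
  obtain ⟨rfl, rfl⟩ := h2
  exact ⟨L ++ [d], y, !d, R', by simp, by simp, L, d, y :: R', rfl, by simp, by simp⟩

theorem slide_cap_symm (k : Kind) (i : ℕ) :
    Red [⟨.cross k.swap, i + 1⟩, ⟨.cap, i⟩] [⟨.cross k, i⟩, ⟨.cap, i + 1⟩] := by
  refine of_move_symm (.slide_cap k i) fun S T h => ?_
  simp only [runs_cap_iff, runs_cross_iff, runs_nil_iff] at h ⊢
  obtain ⟨L, x, y, R, hl, rfl, L', d, R', rfl, he, rfl⟩ := h
  obtain ⟨rfl, h2⟩ := append_cons_split he.symm hl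
  simp only [List.cons.injEq] at h2
  obtain ⟨rfl, rfl⟩ := h2
  exact ⟨L', d, x, (!d) :: R, rfl, by simp, L' ++ [x], d, R, by simp, by simp, by simp⟩

end Red

theorem Kind.swap_swap (k : Kind) : k.swap.swap = k := by cases k <;> rfl

namespace Red

theorem exchange_of {s t : Piece} {i j j' : ℕ} (h : i + s.outs ≤ j)
    (h' : j' + s.outs = j + s.ins) : Red [⟨s, i⟩, ⟨t, j⟩] [⟨t, j'⟩, ⟨s, i⟩] := by
  obtain ⟨d, rfl⟩ := Nat.exists_eq_add_of_le h
  obtain rfl : j' = i + s.ins + d := by omega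
  exact exchange s t i d

theorem exchange_symm_of {s t : Piece} {i j j' : ℕ} (h : i + s.ins ≤ j')
    (h' : j' + s.outs = j + s.ins) : Red [⟨t, j'⟩, ⟨s, i⟩] [⟨s, i⟩, ⟨t, j⟩] := by
  obtain ⟨d, rfl⟩ := Nat.exists_eq_add_of_le h
  obtain rfl : j = i + s.outs + d := by omega
  exact exchange_symm s t i d

end Red

/-! ### Words that represent the same braid -/

theorem letterSlice_eq {n : ℕ} (x : Gen n × Bool) :
    ∃ (k : Kind) (i : ℕ), i + 2 ≤ n ∧ letterSlice x = ⟨.cross k, i⟩ := by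
  rcases x with ⟨⟨i, hi⟩ | ⟨i, hi⟩, _ | _⟩ <;> exact ⟨_, i, by omega, rfl⟩

/-- The words `v` and `w` describe equivalent tangles, with any strands to the right of them. -/
def BraidEquiv {n : ℕ} (v w : BraidWord n) : Prop :=
  ∀ R : List Bool, TangleEquiv (List.replicate n true ++ R) (List.replicate n true ++ R)
    (v.map letterSlice) (w.map letterSlice)

theorem BraidEquiv.of_red {n : ℕ} {v w : BraidWord n}
    (h : Red (v.map letterSlice) (w.map letterSlice)) : BraidEquiv v w :=
  fun R => h _ _ (runs_letters v R)

theorem BraidEquiv.symm {n : ℕ} {v w : BraidWord n} (h : BraidEquiv v w) : BraidEquiv w v :=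
  fun R => (h R).symm

/-- Equivalence of braid words as a congruence. -/
def braidCon (n : ℕ) : Con (FreeMonoid (Gen n × Bool)) where
  r v w := BraidEquiv v.toList w.toList
  iseqv := ⟨fun v R => TangleEquiv.refl (runs_letters v.toList R), fun h => h.symm,
    fun h h' R => (h R).trans (h' R)⟩
  mul' h h' R := by
    simpa only [FreeMonoid.toList_mul, List.map_append] using (h R).append (h' R)

theorem braidEquiv_letter_cancel {n : ℕ} (g : Gen n) (b : Bool) :
    BraidEquiv [(g, b), (g, !b)] [] := by
  apply BraidEquiv.of_red
  cases g <;> cases b <;> exact Red.R2 _ _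

theorem braidEquiv_letters_far {n : ℕ} {g h : Gen n} {k l : Kind} {i j : Fin (n - 1)}
    (hg : letterSlice (g, true) = ⟨.cross k, i⟩) (hh : letterSlice (h, true) = ⟨.cross l, j⟩)
    (hij : Far i j) : BraidEquiv [(g, true), (h, true)] [(h, true), (g, true)] := by
  have key : ∀ {g h : Gen n} {k l : Kind} {i j : Fin (n - 1)},
      letterSlice (g, true) = ⟨.cross k, i⟩ → letterSlice (h, true) = ⟨.cross l, j⟩ →
      (i : ℕ) + 2 ≤ j → BraidEquiv [(g, true), (h, true)] [(h, true), (g, true)] := by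
    intro g h k l i j hg hh hij
    apply BraidEquiv.of_red
    simp only [List.map_cons, List.map_nil, hg, hh]
    exact Red.exchange_of hij rfl
  rcases hij with hij | hij
  · exact key hg hh hij
  · exact (key hh hg hij).symm

/-- The class of a letter. -/
def braidUnit {n : ℕ} (g : Gen n) : (braidCon n).Quotientˣ where
  val := (braidCon n).mk' (FreeMonoid.of (g, true))
  inv := (braidCon n).mk' (FreeMonoid.of (g, false))
  val_inv := (Con.eq _).2 (braidEquiv_letter_cancel g true)
  inv_val := (Con.eq _).2 (braidEquiv_letter_cancel g false)

theorem braidUnit_relators {n : ℕ} :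
    ∀ r ∈ relators n, FreeGroup.lift (braidUnit (n := n)) r = 1 := by
  rintro r ⟨x, y, h, rfl⟩
  rw [map_mul, map_inv, mul_inv_eq_one]
  have R3 : ∀ {a b c : Kind} {x y z x' y' z' : Gen n} {i j : Fin (n - 1)},
      letterSlice (x, true) = ⟨.cross a, i⟩ → letterSlice (y, true) = ⟨.cross b, j⟩ →
      letterSlice (z, true) = ⟨.cross c, i⟩ → letterSlice (z', true) = ⟨.cross c, j⟩ →
      letterSlice (y', true) = ⟨.cross b, i⟩ → letterSlice (x', true) = ⟨.cross a, j⟩ →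
      (j : ℕ) = i + 1 → a.Triangle b c →
      braidUnit x * braidUnit y * braidUnit z = braidUnit z' * braidUnit y' * braidUnit x' := by
    intro a b c x y z x' y' z' i j hx hy hz hz' hy' hx' hij ht
    refine Units.ext ((Con.eq _).2 (BraidEquiv.of_red ?_))
    change Red [letterSlice (x, true), letterSlice (y, true), letterSlice (z, true)]
      [letterSlice (z', true), letterSlice (y', true), letterSlice (x', true)]
    rw [hx, hy, hz, hx', hy', hz', hij]
    exact Red.R3 ht _
  -- Every three-strand relation is a triangle move in which one strand has two crossings of the
  -- same kind: the first strand in B1, P1, M2 and F2, the third in F1. F2 has to be read backwards,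
  -- since a triangle move starts at the smaller index.
  cases h <;> simp only [fσ, fρ, map_mul, map_one, FreeGroup.lift_apply_of]
  case B1 i j h => exact R3 rfl rfl rfl rfl rfl rfl h (.inl rfl)
  case P1 i j h => exact R3 rfl rfl rfl rfl rfl rfl h (.inl rfl)
  case M2 i j h => exact R3 rfl rfl rfl rfl rfl rfl h (.inl rfl)
  case F1 i j h => exact R3 rfl rfl rfl rfl rfl rfl h (.inr (.inl rfl))
  case F2 i j h => exact (R3 rfl rfl rfl rfl rfl rfl h (.inl rfl)).symm
  case P3 i => exact Units.ext ((Con.eq _).2 (braidEquiv_letter_cancel (.rho i) true))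
  all_goals
    exact Units.ext ((Con.eq _).2 (braidEquiv_letters_far rfl rfl ‹Far _ _›))

theorem lift_braidUnit_mk {n : ℕ} (w : BraidWord n) :
    (FreeGroup.lift (braidUnit (n := n)) (FreeGroup.mk w) : (braidCon n).Quotient) =
      (braidCon n).mk' (FreeMonoid.ofList w) := by
  induction w with
  | nil => rfl
  | cons x w ih =>
    have h : FreeGroup.mk (x :: w) = FreeGroup.mk [x] * FreeGroup.mk w := rfl
    have h' : FreeMonoid.ofList (x :: w) = FreeMonoid.of x * FreeMonoid.ofList w := rfl
    rw [h, h', map_mul, map_mul, Units.val_mul, ih]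
    congr 1
    rcases x with ⟨g, _ | _⟩ <;> simp [FreeGroup.lift_mk] <;> rfl

/-- In the monoid of words up to tangle equivalence the letters are units by the second Reidemeister
move, and they satisfy the defining relations of `UVB_n`. The universal property of the presentation
then sends equal braids to equal classes. -/
theorem braidEquiv_of_toUVB_eq {n : ℕ} {v w : BraidWord n} (h : v.toUVB = w.toUVB) :
    BraidEquiv v w := by
  have h1 : FreeGroup.lift (braidUnit (n := n)) (FreeGroup.mk v) =
      FreeGroup.lift braidUnit (FreeGroup.mk w) :=
    congrArg (PresentedGroup.toGroup braidUnit_relators) h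
  have h2 := congrArg Units.val h1
  rw [lift_braidUnit_mk, lift_braidUnit_mk] at h2
  exact (Con.eq _).1 h2

theorem closure_equivalent_of_toUVB_eq {n : ℕ} {v w : BraidWord n} (h : v.toUVB = w.toUVB) :
    v.closure.Equivalent w.closure :=
  (braidEquiv_of_toUVB_eq h (List.replicate n false)).equivalent (cups n) (caps n) _ _
    (runs_cups n) (runs_caps n) rfl rfl

/-! ### Conjugation -/

theorem cups_succ (n : ℕ) : cups (n + 1) = cups n ++ [⟨.cup true, n⟩] := by
  simp [cups, List.range_succ]

theorem caps_succ (n : ℕ) : caps (n + 1) = [⟨.cap, n⟩] ++ caps n := by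
  simp [caps, List.range_succ]

/-- A crossing slides over the nested cups to the mirror position among the returning strands. Each
passage over a cup swaps its kind; it passes over two cups, so that the kind is preserved. -/
theorem red_cups_cross (k : Kind) {n i j : ℕ} (hi : i + 2 ≤ n) (hj : i + j + 2 = 2 * n) :
    Red (cups n ++ [⟨.cross k, i⟩]) (cups n ++ [⟨.cross k, j⟩]) := by
  induction n generalizing j with
  | zero => omega
  | succ n ih =>
    -- The last cup is the innermost one. Either the crossing involves it, and slides over the two
    -- innermost cups, or the crossing lies outside and can be moved before this cup. In the latter
    -- case the mirror position grows by the two strands that the cup adds.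
    rcases Nat.lt_or_ge n (i + 2) with hn | hn
    · obtain rfl : n = i + 1 := by omega
      obtain rfl : j = i + 2 := by omega
      rw [cups_succ, cups_succ]
      simp only [List.append_assoc]
      refine Red.append_left _ ?_
      have h1 : Red [⟨.cup true, i + 1⟩, ⟨.cross k, i⟩]
          [⟨.cup true, i⟩, ⟨.cross k.swap, i + 1⟩] := by
        simpa only [Kind.swap_swap] using Red.slide_cup_symm true k.swap i
      have h2 : Red [⟨.cup true, i⟩, ⟨.cup true, i⟩] [⟨.cup true, i⟩, ⟨.cup true, i + 2⟩] :=
        Red.exchange_symm_of (by simp [Piece.ins]) rfl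
      have h3 : Red [⟨.cup true, i + 2⟩, ⟨.cross k.swap, i + 1⟩]
          [⟨.cup true, i + 1⟩, ⟨.cross k, i + 2⟩] := Red.slide_cup_symm true k (i + 1)
      exact ((h1.append_left [⟨.cup true, i⟩]).trans (h2.append_right _)).trans
        (h3.append_left [⟨.cup true, i⟩])
    · obtain ⟨j, rfl⟩ : ∃ j', j = j' + 2 := ⟨j - 2, by omega⟩
      rw [cups_succ]
      simp only [List.append_assoc]
      have h1 : Red [⟨.cup true, n⟩, ⟨.cross k, i⟩] [⟨.cross k, i⟩, ⟨.cup true, n⟩] :=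
        Red.exchange_symm_of hn rfl
      have h2 : Red [⟨.cross k, j⟩, ⟨.cup true, n⟩] [⟨.cup true, n⟩, ⟨.cross k, j + 2⟩] :=
        Red.exchange_symm_of (by simp only [Piece.ins]; omega) rfl
      have h3 := (ih hn (j := j) (by omega)).append_right [⟨.cup true, n⟩]
      simp only [List.append_assoc] at h3
      exact ((h1.append_left _).trans h3).trans (h2.append_left _)

theorem red_cross_caps (k : Kind) {n i j : ℕ} (hi : i + 2 ≤ n) (hj : i + j + 2 = 2 * n) :
    Red ([⟨.cross k, j⟩] ++ caps n) ([⟨.cross k, i⟩] ++ caps n) := by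
  induction n generalizing j with
  | zero => omega
  | succ n ih =>
    rcases Nat.lt_or_ge n (i + 2) with hn | hn
    · obtain rfl : n = i + 1 := by omega
      obtain rfl : j = i + 2 := by omega
      rw [caps_succ, caps_succ]
      simp only [← List.append_assoc]
      refine Red.append_right ?_ _
      have h1 : Red [⟨.cross k, i + 2⟩, ⟨.cap, i + 1⟩]
          [⟨.cross k.swap, i + 1⟩, ⟨.cap, i + 2⟩] := by
        simpa only [Kind.swap_swap] using Red.slide_cap_symm k.swap (i + 1)
      have h2 : Red [⟨.cap, i + 2⟩, ⟨.cap, i⟩] [⟨.cap, i⟩, ⟨.cap, i⟩] :=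
        Red.exchange_symm_of (by simp [Piece.ins]) rfl
      have h3 : Red [⟨.cross k.swap, i + 1⟩, ⟨.cap, i⟩] [⟨.cross k, i⟩, ⟨.cap, i + 1⟩] :=
        Red.slide_cap_symm k i
      exact ((h1.append_right [⟨.cap, i⟩]).trans (h2.append_left [_])).trans
        (h3.append_right [⟨.cap, i⟩])
    · obtain ⟨j, rfl⟩ : ∃ j', j = j' + 2 := ⟨j - 2, by omega⟩
      rw [caps_succ]
      simp only [← List.append_assoc]
      have h1 : Red [⟨.cross k, j + 2⟩, ⟨.cap, n⟩] [⟨.cap, n⟩, ⟨.cross k, j⟩] :=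
        Red.exchange_symm_of (by simp only [Piece.ins]; omega) rfl
      have h2 : Red [⟨.cap, n⟩, ⟨.cross k, i⟩] [⟨.cross k, i⟩, ⟨.cap, n⟩] :=
        Red.exchange_symm_of hn rfl
      have h3 := (ih hn (j := j) (by omega)).append_left [⟨.cap, n⟩]
      simp only [← List.append_assoc] at h3
      exact ((h1.append_right _).trans h3).trans (h2.append_right _)

/-- A piece to the right of all braid strands is disjoint from the braid. This serves for crossings
of the returning strands and for the innermost cup of a stabilization. -/
theorem red_piece_letters {n : ℕ} (w : BraidWord n) (p : Piece) {j : ℕ} (hj : n ≤ j) :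
    Red ([⟨p, j⟩] ++ w.map letterSlice) (w.map letterSlice ++ [⟨p, j⟩]) := by
  induction w with
  | nil => exact Red.refl _
  | cons x w ih =>
    obtain ⟨k, i, hi, hx⟩ := letterSlice_eq x
    have h1 : Red [⟨p, j⟩, ⟨.cross k, i⟩] [⟨.cross k, i⟩, ⟨p, j⟩] :=
      Red.exchange_symm_of (by simp only [Piece.ins]; omega) rfl
    rw [List.map_cons, hx]
    exact (h1.append_right _).trans (ih.append_left [_])

/-- The first crossing travels over the cups, along the returning strands and back over the caps to
the end of the braid. -/
theorem closure_cons_equivalent {n : ℕ} (x : Gen n × Bool) (w : BraidWord n) :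
    BraidWord.closure (x :: w) |>.Equivalent (BraidWord.closure (w ++ [x])) := by
  obtain ⟨k, i, hi, hx⟩ := letterSlice_eq x
  apply Red.closed
  change Red (cups n ++ (letterSlice x :: w.map letterSlice) ++ caps n)
    (cups n ++ (w ++ [x]).map letterSlice ++ caps n)
  obtain ⟨j, hj⟩ : ∃ j, i + j + 2 = 2 * n := ⟨2 * n - 2 - i, by omega⟩
  have h1 := (red_cups_cross k hi hj).append_right (w.map letterSlice ++ caps n)
  have h2 := ((red_piece_letters w (.cross k) (j := j) (by omega)).append_left
    (cups n)).append_right (caps n)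
  have h3 := (red_cross_caps k hi hj).append_left (cups n ++ w.map letterSlice)
  rw [List.map_append, List.map_cons, List.map_nil, hx]
  simp only [List.append_assoc, List.cons_append, List.nil_append] at h1 h2 h3 ⊢
  exact (h1.trans h2).trans h3

theorem closure_append_equivalent {n : ℕ} (v w : BraidWord n) :
    (BraidWord.closure (v ++ w)).Equivalent (BraidWord.closure (w ++ v)) := by
  induction v generalizing w with
  | nil => simpa using Diagram.Equivalent.refl (BraidWord.closure w)
  | cons x v ih =>
    have h1 := closure_cons_equivalent x (v ++ w)
    have h2 := ih (w ++ [x])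
    simp only [List.append_assoc, List.cons_append, List.nil_append] at h1 h2 ⊢
    exact h1.trans h2

/-! ### Stabilization -/

/-- The generators of the braids on `n` strands as braids on `n + 1` strands. -/
def Gen.succ {n : ℕ} : Gen n → Gen (n + 1)
  | .sigma i => .sigma ⟨i, by omega⟩
  | .rho i => .rho ⟨i, by omega⟩

theorem letterSlice_succ {n : ℕ} (x : Gen n × Bool) :
    letterSlice (x.1.succ, x.2) = letterSlice x := by
  rcases x with ⟨_ | _, _ | _⟩ <;> rfl

theorem closure_stabilization {n : ℕ} (w : BraidWord n) (i : Fin (n + 1 - 1))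
    (hi : (i : ℕ) + 1 = n) :
    (BraidWord.closure (w.map (fun x => (x.1.succ, x.2)) ++ [(Gen.rho i, true)])).Equivalent
      w.closure := by
  apply Red.closed
  change Red (cups (n + 1) ++ (w.map (fun x => (x.1.succ, x.2)) ++
    [(Gen.rho i, true)]).map letterSlice ++ caps (n + 1)) (cups n ++ w.map letterSlice ++ caps n)
  have hw : (w.map fun x => (x.1.succ, x.2)).map letterSlice = w.map letterSlice := by
    rw [List.map_map]
    exact List.map_congr_left fun x _ => letterSlice_succ x
  have hr : letterSlice (Gen.rho i, true) = ⟨.cross .virt, i⟩ := rfl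
  rw [List.map_append, hw, List.map_cons, List.map_nil, hr, cups_succ, caps_succ]
  have h1 := (red_piece_letters w (.cup true) le_rfl).append_left (cups n) |>.append_right
    ([⟨.cross .virt, i⟩, ⟨.cap, n⟩] ++ caps n)
  -- Sliding the virtual crossing over the cap turns it into a kink on the cup. The first virtual
  -- move removes the kink and reverses the cup; a zigzag remains.
  have h2 : Red [⟨.cup true, n⟩, ⟨.cross .virt, i⟩, ⟨.cap, n⟩] [] := by
    have a1 : Red [⟨.cross .virt, i⟩, ⟨.cap, n⟩] [⟨.cross .virt, n⟩, ⟨.cap, i⟩] := by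
      simpa only [hi, Kind.swap] using Red.slide_cap .virt i
    have a2 : Red [⟨.cup true, n⟩, ⟨.cross .virt, n⟩] [⟨.cup false, n⟩] := Red.R1_cup true _ n
    have a3 : Red [⟨.cup false, n⟩, ⟨.cap, i⟩] [] := by
      simpa only [hi] using Red.zigzag_left false i
    exact ((a1.append_left [⟨.cup true, n⟩]).trans (a2.append_right [⟨.cap, i⟩])).trans a3
  have h3 := (h2.append_left (cups n ++ w.map letterSlice)).append_right (caps n)
  simp only [List.append_assoc, List.cons_append, List.nil_append] at h1 h3 ⊢
  exact h1.trans h3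

/-! ### Braids with equivalent closures -/

/-- The diagrams of the closures of `x` and `y` are equivalent. -/
def ClosureEquiv {n m : ℕ} (x : UVB n) (y : UVB m) : Prop :=
  ∀ D E : Diagram, IsClosure x D → IsClosure y E → D.Equivalent E

theorem exists_toUVB_eq {n : ℕ} (x : UVB n) : ∃ w : BraidWord n, w.toUVB = x := by
  obtain ⟨y, rfl⟩ := PresentedGroup.mk_surjective (relators n) x
  obtain ⟨w, rfl⟩ := Quot.exists_rep y
  exact ⟨w, rfl⟩

theorem toUVB_append {n : ℕ} (v w : BraidWord n) :
    BraidWord.toUVB (v ++ w) = v.toUVB * w.toUVB := rfl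

namespace ClosureEquiv

variable {n m l : ℕ} {x : UVB n} {y : UVB m} {z : UVB l}

theorem of_words {v : BraidWord n} {w : BraidWord m} (hv : v.toUVB = x) (hw : w.toUVB = y)
    (h : v.closure.Equivalent w.closure) : ClosureEquiv x y := by
  rintro D E ⟨v', hv', rfl⟩ ⟨w', hw', rfl⟩
  exact (closure_equivalent_of_toUVB_eq (hv'.trans hv.symm)).trans
    (h.trans (closure_equivalent_of_toUVB_eq (hw.trans hw'.symm)))

theorem refl (x : UVB n) : ClosureEquiv x x := by
  obtain ⟨w, hw⟩ := exists_toUVB_eq x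
  exact of_words hw hw (Diagram.Equivalent.refl _)

theorem of_eq {x y : UVB n} (h : x = y) : ClosureEquiv x y := h ▸ refl x

theorem symm (h : ClosureEquiv x y) : ClosureEquiv y x := fun D E hD hE => (h E D hE hD).symm

theorem trans (h : ClosureEquiv x y) (h' : ClosureEquiv y z) : ClosureEquiv x z := by
  intro D E hD hE
  obtain ⟨w, hw⟩ := exists_toUVB_eq y
  exact (h D w.closure hD ⟨w, hw, rfl⟩).trans (h' w.closure E ⟨w, hw, rfl⟩ hE)

theorem mul_comm (x y : UVB n) : ClosureEquiv (x * y) (y * x) := by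
  obtain ⟨v, rfl⟩ := exists_toUVB_eq x
  obtain ⟨w, rfl⟩ := exists_toUVB_eq y
  exact of_words (toUVB_append v w) (toUVB_append w v) (closure_append_equivalent v w)

theorem conj (g x : UVB n) : ClosureEquiv (g * x * g⁻¹) x := by
  have h := mul_comm (g * x) g⁻¹
  rwa [← mul_assoc, inv_mul_cancel, one_mul] at h

end ClosureEquiv

/-! ### Adding a strand -/

theorem mk_eq_of_rel {n : ℕ} {x y : FreeGroup (Gen n)} (h : Rel n x y) :
    PresentedGroup.mk (relators n) x = PresentedGroup.mk (relators n) y :=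
  PresentedGroup.mk_eq_mk_of_mul_inv_mem ⟨x, y, h, rfl⟩

theorem Rel.succ {n : ℕ} {x y : FreeGroup (Gen n)} (h : Rel n x y) :
    Rel (n + 1) (FreeGroup.map Gen.succ x) (FreeGroup.map Gen.succ y) := by
  cases h <;> simp only [fσ, fρ, map_mul, map_one, FreeGroup.map.of, Gen.succ]
  case B1 h => exact .B1 _ _ h
  case B2 h => exact .B2 _ _ h
  case P1 h => exact .P1 _ _ h
  case P2 h => exact .P2 _ _ h
  case P3 => exact .P3 _
  case M1 h => exact .M1 _ _ h
  case M2 h => exact .M2 _ _ h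
  case F1 h => exact .F1 _ _ h
  case F2 h => exact .F2 _ _ h

theorem lift_succ {n : ℕ} (x : FreeGroup (Gen n)) :
    FreeGroup.lift (fun g => (PresentedGroup.of g.succ : UVB (n + 1))) x =
      PresentedGroup.mk (relators (n + 1)) (FreeGroup.map Gen.succ x) := by
  have h : FreeGroup.lift (fun g => (PresentedGroup.of g.succ : UVB (n + 1))) =
      (PresentedGroup.mk (relators (n + 1))).comp (FreeGroup.map Gen.succ) := by
    ext g
    simp [PresentedGroup.of]
  rw [h]
  rfl

theorem lift_succ_relators {n : ℕ} : ∀ r ∈ relators n,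
    FreeGroup.lift (fun g => (PresentedGroup.of g.succ : UVB (n + 1))) r = 1 := by
  rintro r ⟨x, y, h, rfl⟩
  rw [map_mul, map_inv, mul_inv_eq_one, lift_succ, lift_succ]
  exact mk_eq_of_rel h.succ

/-- The homomorphism that adds a strand on the right. -/
def addStrand (n : ℕ) : UVB n →* UVB (n + 1) := PresentedGroup.toGroup lift_succ_relators

theorem addStrand_of {n : ℕ} (g : Gen n) :
    addStrand n (PresentedGroup.of g) = PresentedGroup.of g.succ :=
  PresentedGroup.toGroup.of lift_succ_relators

theorem iota_of {n : ℕ} (g : Gen n) : iota n (PresentedGroup.of g) = genPerm g :=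
  PresentedGroup.toGroup.of genPerm_relators

theorem toUVB_map_succ {n : ℕ} (w : BraidWord n) :
    BraidWord.toUVB (w.map fun x => (x.1.succ, x.2)) = addStrand n w.toUVB := by
  exact (lift_succ (FreeGroup.mk w)).symm

/-- A property of all generators that is compatible with the group structure holds everywhere. -/
theorem uvb_induction {n : ℕ} {P : UVB n → Prop} (x : UVB n) (one : P 1)
    (of : ∀ g, P (PresentedGroup.of g)) (mul : ∀ x y, P x → P y → P (x * y))
    (inv : ∀ x, P x → P x⁻¹) : P x := by
  let H : Subgroup (UVB n) :=
    { carrier := {x | P x}, one_mem' := one, mul_mem' := fun hx hy => mul _ _ hx hy,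
      inv_mem' := fun hx => inv _ hx }
  exact PresentedGroup.generated_by (relators n) H of x

theorem tau_succ_castSucc {n : ℕ} (i : Fin (n - 1)) (h : (i : ℕ) < n + 1 - 1) (k : Fin n) :
    tau (n := n + 1) ⟨i, h⟩ k.castSucc = (tau i k).castSucc := by
  have hi := i.2
  simp only [tau, Equiv.swap_apply_def, Fin.ext_iff, Fin.val_castSucc]
  split_ifs <;> rfl

theorem tau_succ_last {n : ℕ} (i : Fin (n - 1)) (h : (i : ℕ) < n + 1 - 1) :
    tau (n := n + 1) ⟨i, h⟩ (Fin.last n) = Fin.last n := by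
  have hi := i.2
  refine Equiv.swap_apply_of_ne_of_ne ?_ ?_ <;> simp only [ne_eq, Fin.ext_iff, Fin.val_last] <;>
    omega

theorem iota_addStrand {n : ℕ} (x : UVB n) :
    (∀ k : Fin n, iota (n + 1) (addStrand n x) k.castSucc = (iota n x k).castSucc) ∧
      iota (n + 1) (addStrand n x) (Fin.last n) = Fin.last n := by
  induction x using uvb_induction with
  | one => simp
  | of g =>
    rw [addStrand_of, iota_of, iota_of]
    cases g <;> exact ⟨tau_succ_castSucc _ _, tau_succ_last _ _⟩
  | mul x y hx hy =>
    simp only [map_mul, Equiv.Perm.mul_apply, hx.1, hy.1, hx.2, hy.2, implies_true, and_self]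
  | inv x hx =>
    simp only [map_inv, Equiv.Perm.inv_eq_iff_eq, hx.1, hx.2, and_true]
    simp

/-! ### The symmetric group in `UVB_n` -/

/-- The generator `ρ_i`, or `1` if there is no generator with this index. -/
def rhoNat (n i : ℕ) : UVB n :=
  if h : i < n - 1 then PresentedGroup.of (Gen.rho ⟨i, h⟩) else 1

theorem rhoNat_of_lt {n i : ℕ} (h : i < n - 1) :
    rhoNat n i = PresentedGroup.of (Gen.rho ⟨i, h⟩) := dif_pos h

theorem rho_mul_self {n : ℕ} (i : Fin (n - 1)) :
    (PresentedGroup.of (Gen.rho i) : UVB n) * PresentedGroup.of (Gen.rho i) = 1 :=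
  mk_eq_of_rel (Rel.P3 i)

theorem rhoNat_mul_self (n i : ℕ) : rhoNat n i * rhoNat n i = 1 := by
  unfold rhoNat
  split_ifs with h
  · exact rho_mul_self _
  · simp

theorem rhoNat_commute {n i j : ℕ} (h : i + 2 ≤ j) : Commute (rhoNat n i) (rhoNat n j) := by
  unfold rhoNat
  split_ifs with h1 h2
  · exact mk_eq_of_rel (Rel.P2 _ _ (.inl h))
  all_goals simp

theorem rhoNat_braid {n i : ℕ} (h : i + 1 < n - 1) :
    rhoNat n i * rhoNat n (i + 1) * rhoNat n i =
      rhoNat n (i + 1) * rhoNat n i * rhoNat n (i + 1) := by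
  rw [rhoNat_of_lt h, rhoNat_of_lt (by omega : i < n - 1)]
  exact mk_eq_of_rel (Rel.P1 _ _ rfl)

theorem rhoNat_mem {n i : ℕ} (h : i < n - 1) : rhoNat n i ∈ symmSubgroup n := by
  rw [rhoNat_of_lt h]
  exact Subgroup.subset_closure ⟨_, rfl⟩

theorem addStrand_rhoNat {n i : ℕ} (h : i < n - 1) :
    addStrand n (rhoNat n i) = rhoNat (n + 1) i := by
  rw [rhoNat_of_lt h, rhoNat_of_lt (by omega : i < n + 1 - 1), addStrand_of]
  rfl

/-- The descending product `ρ_{k+t-1} ⋯ ρ_k`. -/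
def rhoDesc (n : ℕ) : ℕ → ℕ → UVB n
  | _, 0 => 1
  | k, t + 1 => rhoDesc n (k + 1) t * rhoNat n k

theorem rhoNat_commute_desc {n i k : ℕ} (t : ℕ) (h : i + 2 ≤ k) :
    Commute (rhoNat n i) (rhoDesc n k t) := by
  induction t generalizing k with
  | zero => exact Commute.one_right _
  | succ t ih => exact (ih (by omega)).mul_right (rhoNat_commute h)

/-- The generator commutes with the lower factors until it meets `ρ_{i+1} ρ_i`, where the braid
relation lowers its index by one; it then commutes with the higher factors. -/
theorem rhoDesc_mul_rhoNat {n i k t : ℕ} (hk : k ≤ i) (hi : i + 1 < k + t)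
    (hn : i + 1 < n - 1) :
    rhoDesc n k t * rhoNat n (i + 1) = rhoNat n i * rhoDesc n k t := by
  induction t generalizing k with
  | zero => omega
  | succ t ih =>
    rcases Nat.lt_or_ge k i with h | h
    · rw [rhoDesc, mul_assoc, (rhoNat_commute (by omega : k + 2 ≤ i + 1)).eq, ← mul_assoc,
        ih (by omega) (by omega), mul_assoc]
    · obtain rfl : k = i := by omega
      obtain ⟨t, rfl⟩ : ∃ t', t = t' + 1 := ⟨t - 1, by omega⟩
      rw [rhoDesc, rhoDesc]
      calc rhoDesc n (k + 1 + 1) t * rhoNat n (k + 1) * rhoNat n k * rhoNat n (k + 1)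
          = rhoDesc n (k + 1 + 1) t * (rhoNat n (k + 1) * rhoNat n k * rhoNat n (k + 1)) := by
            group
        _ = rhoDesc n (k + 1 + 1) t * rhoNat n k * rhoNat n (k + 1) * rhoNat n k := by
            rw [← rhoNat_braid hn]; group
        _ = _ := by
            rw [← (rhoNat_commute_desc t (by omega : k + 2 ≤ k + 1 + 1)).eq]; group

theorem iota_rhoDesc {n k t : ℕ} (h : k + t < n) :
    iota n (rhoDesc n k t) ⟨k, by omega⟩ = ⟨k + t, h⟩ := by
  induction t generalizing k with
  | zero => simp [rhoDesc]
  | succ t ih =>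
    have h1 : iota n (rhoNat n k) ⟨k, by omega⟩ = ⟨k + 1, by omega⟩ := by
      rw [rhoNat_of_lt (by omega), iota_of]
      exact Equiv.swap_apply_left _ _
    rw [rhoDesc, map_mul, Equiv.Perm.mul_apply, h1, ih (by omega)]
    simp only [Fin.mk.injEq]
    omega

/-- This is the coset normal form of the symmetric group, derived from the relations alone: right
multiplication by a generator preserves the form. -/
theorem exists_eq_addStrand_mul_desc {n : ℕ} {x : UVB (n + 1)} (hx : x ∈ symmSubgroup (n + 1)) :
    ∃ y ∈ symmSubgroup n, ∃ k t, k + t = n ∧ x = addStrand n y * rhoDesc (n + 1) k t := by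
  have step : ∀ i : Fin (n + 1 - 1), ∀ x : UVB (n + 1),
      (∃ y ∈ symmSubgroup n, ∃ k t, k + t = n ∧ x = addStrand n y * rhoDesc (n + 1) k t) →
      ∃ y ∈ symmSubgroup n, ∃ k t, k + t = n ∧
        x * rhoNat (n + 1) i = addStrand n y * rhoDesc (n + 1) k t := by
    rintro ⟨i, hi⟩ x ⟨y, hy, k, t, hkt, rfl⟩
    simp only
    -- For `i + 1 < k` the generator passes to the left factor, for `i + 1 = k` it lengthens the
    -- descending product, for `i = k` it cancels the last factor, and for `i > k` it passes to the
    -- left factor with its index lowered.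
    rcases Nat.lt_trichotomy i k with h | rfl | h
    · rcases Nat.lt_or_ge (i + 1) k with h' | h'
      · refine ⟨y * rhoNat n i, mul_mem hy (rhoNat_mem (by omega)), k, t, hkt, ?_⟩
        rw [map_mul, addStrand_rhoNat (by omega), mul_assoc, mul_assoc,
          (rhoNat_commute_desc t h').eq]
      · obtain rfl : k = i + 1 := by omega
        exact ⟨y, hy, i, t + 1, by omega, by rw [rhoDesc, mul_assoc]⟩
    · obtain ⟨t, rfl⟩ : ∃ t', t = t' + 1 := ⟨t - 1, by omega⟩
      refine ⟨y, hy, i + 1, t, by omega, ?_⟩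
      rw [rhoDesc, mul_assoc, mul_assoc, rhoNat_mul_self, mul_one]
    · obtain ⟨i, rfl⟩ : ∃ i', i = i' + 1 := ⟨i - 1, by omega⟩
      refine ⟨y * rhoNat n i, mul_mem hy (rhoNat_mem (by omega)), k, t, hkt, ?_⟩
      rw [map_mul, addStrand_rhoNat (by omega), mul_assoc, mul_assoc,
        rhoDesc_mul_rhoNat (by omega) (by omega) (by omega)]
  induction hx using Subgroup.closure_induction_right with
  | one => exact ⟨1, one_mem _, n, 0, rfl, by simp [rhoDesc]⟩
  | mul_right x hx y hy ih =>
    obtain ⟨i, rfl⟩ := hy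
    have := step i x ih
    rwa [rhoNat_of_lt i.2] at this
  | mul_inv_cancel x hx y hy ih =>
    obtain ⟨i, rfl⟩ := hy
    have := step i x ih
    rw [rhoNat_of_lt i.2] at this
    rwa [inv_eq_of_mul_eq_one_right (rho_mul_self i)]

/-- In the normal form the permutation sends `k` to the last strand. If it is trivial, the
descending product is empty and induction applies to the remaining factor. -/
theorem eq_one_of_mem_symmSubgroup {n : ℕ} {x : UVB n} (hx : x ∈ symmSubgroup n)
    (h : iota n x = 1) : x = 1 := by
  induction n with
  | zero =>
    have : IsEmpty (Fin (0 - 1)) := inferInstanceAs (IsEmpty (Fin 0))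
    rw [symmSubgroup, Set.range_eq_empty, Subgroup.closure_empty] at hx
    exact Subgroup.mem_bot.1 hx
  | succ n ih =>
    obtain ⟨y, hy, k, t, hkt, rfl⟩ := exists_eq_addStrand_mul_desc hx
    have h1 : iota (n + 1) (addStrand n y * rhoDesc (n + 1) k t) ⟨k, by omega⟩ =
        Fin.last n := by
      rw [map_mul, Equiv.Perm.mul_apply, iota_rhoDesc (by omega)]
      simp only [hkt]
      exact (iota_addStrand y).2
    rw [h, Equiv.Perm.one_apply, Fin.ext_iff, Fin.val_last] at h1
    simp only at h1
    obtain rfl : t = 0 := by omega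
    rw [rhoDesc, mul_one] at h ⊢
    have h2 : iota n y = 1 := by
      ext k : 1
      have := (iota_addStrand y).1 k
      rw [h] at this
      exact (Fin.castSucc_injective n this).symm
    rw [ih hy h2, map_one]

theorem map_iota_symmSubgroup (n : ℕ) : (symmSubgroup n).map (iota n) = ⊤ := by
  rcases n with _ | n
  · exact Subsingleton.elim _ _
  · rw [← top_le_iff, ← Subgroup.toSubmonoid_le, Subgroup.top_toSubmonoid,
      ← Equiv.Perm.mclosure_swap_castSucc_succ n, Submonoid.closure_le]
    rintro _ ⟨i, rfl⟩
    exact ⟨_, rhoNat_mem (i := i) i.2, by rw [rhoNat_of_lt i.2, iota_of]; rfl⟩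

theorem bijective_iota_symmSubgroup (n : ℕ) :
    Function.Bijective ((iota n).comp (symmSubgroup n).subtype) := by
  constructor
  · rw [injective_iff_map_eq_one]
    rintro ⟨x, hx⟩ h
    exact Subtype.ext (eq_one_of_mem_symmSubgroup hx h)
  · intro g
    have hg : g ∈ (symmSubgroup n).map (iota n) := map_iota_symmSubgroup n ▸ Subgroup.mem_top g
    obtain ⟨x, hx, rfl⟩ := hg
    exact ⟨⟨x, hx⟩, rfl⟩

/-- The embedding `S_n → UVB_n` with `τ_i ↦ ρ_i`. -/
noncomputable def permBraid (n : ℕ) : Equiv.Perm (Fin n) →* UVB n :=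
  (symmSubgroup n).subtype.comp
    (MulEquiv.ofBijective _ (bijective_iota_symmSubgroup n)).symm.toMonoidHom

theorem permBraid_mem {n : ℕ} (g : Equiv.Perm (Fin n)) : permBraid n g ∈ symmSubgroup n :=
  Subtype.prop _

theorem iota_permBraid {n : ℕ} (g : Equiv.Perm (Fin n)) : iota n (permBraid n g) = g :=
  (MulEquiv.ofBijective _ (bijective_iota_symmSubgroup n)).apply_symm_apply g

theorem permBraid_iota {n : ℕ} {x : UVB n} (hx : x ∈ symmSubgroup n) :
    permBraid n (iota n x) = x :=
  congrArg Subtype.val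
    ((MulEquiv.ofBijective _ (bijective_iota_symmSubgroup n)).symm_apply_apply ⟨x, hx⟩)

theorem permBraid_tau {n : ℕ} (i : Fin (n - 1)) :
    permBraid n (tau i) = PresentedGroup.of (Gen.rho i) := by
  have h := permBraid_iota (rhoNat_mem i.2)
  rwa [rhoNat_of_lt i.2, iota_of] at h

theorem addStrand_mem_symmSubgroup {n : ℕ} {x : UVB n} (hx : x ∈ symmSubgroup n) :
    addStrand n x ∈ symmSubgroup (n + 1) := by
  have h : (symmSubgroup n).map (addStrand n) ≤ symmSubgroup (n + 1) := by
    rw [symmSubgroup, MonoidHom.map_closure, Subgroup.closure_le]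
    rintro _ ⟨_, ⟨i, rfl⟩, rfl⟩
    simp only [addStrand_of]
    exact Subgroup.subset_closure ⟨_, rfl⟩
  exact h ⟨x, hx, rfl⟩

theorem exists_addStrand_permBraid {n : ℕ} (g : Equiv.Perm (Fin n)) :
    ∃ h : Equiv.Perm (Fin (n + 1)), addStrand n (permBraid n g) = permBraid (n + 1) h ∧
      (∀ k : Fin n, h k.castSucc = (g k).castSucc) ∧ h (Fin.last n) = Fin.last n := by
  refine ⟨iota (n + 1) (addStrand n (permBraid n g)),
    (permBraid_iota (addStrand_mem_symmSubgroup (permBraid_mem g))).symm, ?_, ?_⟩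
  · intro k
    rw [(iota_addStrand _).1, iota_permBraid]
  · exact (iota_addStrand _).2

/-- The closure does not change if a strand is cut and its ends are joined to a new strand. -/
theorem closureEquiv_cut {n : ℕ} (x y : UVB n) (i : Fin n) :
    ClosureEquiv
      (addStrand n x * permBraid (n + 1) (Equiv.swap i.castSucc (Fin.last n)) * addStrand n y)
      (x * y) := by
  obtain ⟨m, rfl⟩ : ∃ m, n = m + 1 := ⟨n - 1, by have := i.2; omega⟩
  obtain ⟨f, hf, hf1, hf2⟩ := exists_addStrand_permBraid (Equiv.swap (Fin.last m) i)
  set h := permBraid (m + 1) (Equiv.swap (Fin.last m) i) with hh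
  let j : Fin (m + 1 + 1 - 1) := Fin.last m
  -- `f` comes from the old strands, so conjugation reduces the rerouting at strand `i` to a
  -- stabilization at the last old strand.
  have hj : Equiv.swap i.castSucc (Fin.last (m + 1)) = f * tau j * f⁻¹ := by
    rw [show tau j = Equiv.swap (Fin.last m).castSucc (Fin.last (m + 1)) from rfl,
      ← Equiv.swap_apply_apply, hf1, hf2, Equiv.swap_apply_left]
  have stab : ∀ z : UVB (m + 1),
      ClosureEquiv (addStrand (m + 1) z * PresentedGroup.of (Gen.rho j)) z := by
    intro z
    obtain ⟨w, rfl⟩ := exists_toUVB_eq z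
    refine .of_words ?_ rfl (closure_stabilization w j rfl)
    rw [toUVB_append, toUVB_map_succ]
    rfl
  rw [hj, map_mul, map_mul, map_inv, permBraid_tau, ← hf]
  set e := addStrand (m + 1)
  refine ClosureEquiv.trans (ClosureEquiv.mul_comm _ _) ?_
  have h1 := ClosureEquiv.conj (e h)⁻¹
    (e y * (e x * (e h * PresentedGroup.of (Gen.rho j) * (e h)⁻¹)))
  have h2 : (e h)⁻¹ * (e y * (e x * (e h * PresentedGroup.of (Gen.rho j) * (e h)⁻¹))) *
      (e h)⁻¹⁻¹ = e (h⁻¹ * (y * x) * h⁻¹⁻¹) * PresentedGroup.of (Gen.rho j) := by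
    simp only [map_mul, map_inv]
    group
  rw [h2] at h1
  exact h1.symm.trans ((stab _).trans ((ClosureEquiv.conj _ _).trans (ClosureEquiv.mul_comm _ _)))

/-! ### Generators of the pure group -/

/-- The element `σ_i ρ_i` of the pure group. -/
def pureGen {n : ℕ} (i : Fin (n - 1)) : UVB n :=
  PresentedGroup.of (Gen.sigma i) * PresentedGroup.of (Gen.rho i)

/-- The conjugate of `σ_0 ρ_0` by a permutation. -/
noncomputable def pureConj {m : ℕ} (g : Equiv.Perm (Fin (m + 2))) : UVB (m + 2) :=
  permBraid (m + 2) g * pureGen ⟨0, by omega⟩ * (permBraid (m + 2) g)⁻¹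

theorem permBraid_conj_pureConj {m : ℕ} (f g : Equiv.Perm (Fin (m + 2))) :
    permBraid (m + 2) f * pureConj g * (permBraid (m + 2) f)⁻¹ = pureConj (f * g) := by
  simp only [pureConj, map_mul]
  group

theorem commute_pureGen_rho {n : ℕ} {i j : Fin (n - 1)} (h : Far i j) :
    Commute (PresentedGroup.of (Gen.rho j)) (pureGen i) :=
  .mul_right (mk_eq_of_rel (Rel.M1 i j h)).symm (mk_eq_of_rel (Rel.P2 i j h)).symm

theorem commute_pureGen_pureGen {n : ℕ} {i j : Fin (n - 1)} (h : Far i j) :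
    Commute (pureGen j) (pureGen i) := by
  refine .mul_left (.mul_right ?_ ?_) (commute_pureGen_rho h)
  · exact (mk_eq_of_rel (Rel.B2 i j h)).symm
  · exact mk_eq_of_rel (Rel.M1 j i (Or.symm h))

theorem commute_swap_pureGen {m : ℕ} {i j : Fin (m + 2)} (hi : 2 ≤ (i : ℕ)) (hij : i < j) :
    Commute (permBraid (m + 2) (Equiv.swap i j)) (pureGen ⟨0, by omega⟩) := by
  obtain ⟨i, hi'⟩ := i
  obtain ⟨j, hj⟩ := j
  simp only [Fin.mk_lt_mk] at hi hij
  induction j, hij using Nat.le_induction with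
  | base =>
    have := permBraid_tau (n := m + 2) ⟨i, by omega⟩
    rw [tau] at this
    rw [this]
    exact commute_pureGen_rho (.inl (by simpa using hi))
  | succ j hij ih =>
    have h1 := permBraid_tau (n := m + 2) ⟨j, by omega⟩
    have h2 : Commute (PresentedGroup.of (Gen.rho (⟨j, by omega⟩ : Fin (m + 2 - 1))))
        (pureGen (⟨0, by omega⟩ : Fin (m + 2 - 1))) :=
      commute_pureGen_rho (.inl (by simp only; omega))
    have h3 : Equiv.swap (⟨i, hi'⟩ : Fin (m + 2)) ⟨j + 1, hj⟩ =
        tau ⟨j, by omega⟩ * Equiv.swap ⟨i, hi'⟩ ⟨j, by omega⟩ * (tau ⟨j, by omega⟩)⁻¹ := by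
      rw [← Equiv.swap_apply_apply, tau, Equiv.swap_apply_left, Equiv.swap_apply_of_ne_of_ne]
      all_goals simp only [ne_eq, Fin.mk.injEq]; omega
    rw [h3, map_mul, map_mul, map_inv, h1]
    exact (h2.mul_left (ih (by omega))).mul_left h2.inv_left

/-- Such a permutation is a product of transpositions of strands from `2` on, and each of these
commutes with `σ_0 ρ_0` by the far relations. The induction splits off one transposition and shrinks
the support. Hence a conjugate of `σ_0 ρ_0` depends only on the images of `0` and `1`, which makes
`λ_ij` independent of the chosen permutation. -/
theorem commute_permBraid_pureGen {m : ℕ} (g : Equiv.Perm (Fin (m + 2))) (h0 : g 0 = 0)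
    (h1 : g 1 = 1) : Commute (permBraid (m + 2) g) (pureGen ⟨0, by omega⟩) := by
  induction hc : g.support.card using Nat.strong_induction_on generalizing g with
  | _ c ih =>
    subst hc
    by_cases hg : g = 1
    · rw [hg, map_one]
      exact Commute.one_left _
    · obtain ⟨x, hx⟩ : ∃ x, g x ≠ x := by
        by_contra! h
        exact hg (Equiv.ext h)
      have big : ∀ y : Fin (m + 2), y ≠ 0 → y ≠ 1 → 2 ≤ (y : ℕ) := by
        intro y hy0 hy1
        rw [ne_eq, Fin.ext_iff] at hy0 hy1
        simp only [Fin.val_zero, Fin.val_one] at hy0 hy1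
        omega
      have hx0 : x ≠ 0 := by rintro rfl; exact hx h0
      have hx1 : x ≠ 1 := by rintro rfl; exact hx h1
      have hy0 : g x ≠ 0 := fun h => hx0 (g.injective (h.trans h0.symm))
      have hy1 : g x ≠ 1 := fun h => hx1 (g.injective (h.trans h1.symm))
      have hs : Commute (permBraid (m + 2) (Equiv.swap x (g x))) (pureGen ⟨0, by omega⟩) := by
        rcases lt_or_gt_of_ne hx with h | h
        · rw [Equiv.swap_comm]
          exact commute_swap_pureGen (big _ hy0 hy1) h
        · exact commute_swap_pureGen (big _ hx0 hx1) h
      have h2 := ih _ (Equiv.Perm.card_support_swap_mul hx) (Equiv.swap x (g x) * g)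
        (by rw [Equiv.Perm.mul_apply, h0, Equiv.swap_apply_of_ne_of_ne hx0.symm hy0.symm])
        (by rw [Equiv.Perm.mul_apply, h1, Equiv.swap_apply_of_ne_of_ne hx1.symm hy1.symm]) rfl
      have h3 : g = Equiv.swap x (g x) * (Equiv.swap x (g x) * g) := by
        rw [← mul_assoc, Equiv.swap_mul_self, one_mul]
      rw [h3, map_mul]
      exact hs.mul_left h2

theorem pureConj_eq {m : ℕ} {f g : Equiv.Perm (Fin (m + 2))} (h0 : f 0 = g 0) (h1 : f 1 = g 1) :
    pureConj f = pureConj g := by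
  have h := commute_permBraid_pureGen (f⁻¹ * g) (by simp [← h0]) (by simp [← h1])
  have h2 : pureConj (f * (f⁻¹ * g)) = pureConj f := by
    rw [← permBraid_conj_pureConj f]
    have h3 : pureConj (f⁻¹ * g) = pureGen ⟨0, by omega⟩ := by
      rw [pureConj, h.eq, mul_inv_cancel_right]
    rw [h3, pureConj]
  rw [← h2, mul_inv_cancel_left]

/-- The pure braid `λ_{ij}`: the conjugate of `σ_0 ρ_0` by a permutation with `0 ↦ i`, `1 ↦ j`. -/
noncomputable def lam {m : ℕ} (i j : Fin (m + 2)) : UVB (m + 2) :=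
  pureConj (Equiv.swap 0 i * Equiv.swap 1 (Equiv.swap 0 i j))

theorem exists_perm_two {m : ℕ} {i j : Fin (m + 2)} (hij : i ≠ j) :
    ∃ g : Equiv.Perm (Fin (m + 2)), g 0 = i ∧ g 1 = j ∧ lam i j = pureConj g := by
  refine ⟨Equiv.swap 0 i * Equiv.swap 1 (Equiv.swap 0 i j), ?_, ?_, rfl⟩
  · have h : (0 : Fin (m + 2)) ≠ Equiv.swap 0 i j := by
      intro h
      have h' := congrArg (Equiv.swap 0 i) h
      rw [Equiv.swap_apply_left, Equiv.swap_apply_self] at h'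
      exact hij h'
    rw [Equiv.Perm.mul_apply, Equiv.swap_apply_of_ne_of_ne (zero_ne_one) h,
      Equiv.swap_apply_left]
  · rw [Equiv.Perm.mul_apply, Equiv.swap_apply_left, Equiv.swap_apply_self]

theorem pureConj_eq_lam {m : ℕ} (g : Equiv.Perm (Fin (m + 2))) :
    pureConj g = lam (g 0) (g 1) := by
  obtain ⟨f, h0, h1, h⟩ := exists_perm_two (g.injective.ne (zero_ne_one (α := Fin (m + 2))))
  rw [h, pureConj_eq h0 h1]

theorem permBraid_conj_lam {m : ℕ} (f : Equiv.Perm (Fin (m + 2))) {i j : Fin (m + 2)}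
    (hij : i ≠ j) :
    permBraid (m + 2) f * lam i j * (permBraid (m + 2) f)⁻¹ = lam (f i) (f j) := by
  obtain ⟨g, rfl, rfl, h⟩ := exists_perm_two hij
  rw [h, permBraid_conj_pureConj, pureConj_eq_lam]
  rfl

theorem permBraid_mul_lam {m : ℕ} (f : Equiv.Perm (Fin (m + 2))) {i j : Fin (m + 2)}
    (hij : i ≠ j) :
    permBraid (m + 2) f * lam i j = lam (f i) (f j) * permBraid (m + 2) f := by
  rw [← permBraid_conj_lam f hij, inv_mul_cancel_right]

theorem addStrand_lam {m : ℕ} {i j : Fin (m + 2)} (hij : i ≠ j) :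
    addStrand (m + 2) (lam i j) = lam (m := m + 1) i.castSucc j.castSucc := by
  obtain ⟨g, rfl, rfl, h⟩ := exists_perm_two hij
  obtain ⟨f, hf, hf1, -⟩ := exists_addStrand_permBraid g
  have h2 : addStrand (m + 2) (pureGen ⟨0, by omega⟩) =
      pureGen (n := m + 3) ⟨0, by omega⟩ := by
    rw [pureGen, map_mul, addStrand_of, addStrand_of]
    rfl
  have h3 : addStrand (m + 2) (lam (g 0) (g 1)) = pureConj (m := m + 1) f := by
    rw [h, pureConj, map_mul, map_mul, map_inv, hf, h2]
    rfl
  rw [h3, pureConj_eq_lam, ← hf1, ← hf1]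
  rfl

theorem mixed_relation_conj {G : Type*} [Group G] {s t p q : G} (h : p * q * s = t * p * q)
    (hpq : p * q * p = q * p * q) : t * q * (p * q) = p * q * (s * p) := by
  rw [← mul_assoc (p * q), h, mul_assoc, ← mul_assoc q p q, ← hpq]
  simp only [mul_assoc]

/-- By the mixed relation M2, conjugation by `ρ_i ρ_{i+1}` shifts `σ_i ρ_i` to the next index, just
as the permutation shifts the pair `(i, i + 1)`. -/
theorem pureGen_eq_lam {m : ℕ} (i : ℕ) (hi : i < m + 2 - 1) :
    pureGen ⟨i, hi⟩ = lam (⟨i, by omega⟩ : Fin (m + 2)) ⟨i + 1, by omega⟩ := by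
  induction i with
  | zero =>
    have h : pureGen ⟨0, hi⟩ = pureConj (m := m) 1 := by simp [pureConj]
    rw [h, pureConj_eq_lam]
    rfl
  | succ i ih =>
    let a : Fin (m + 2 - 1) := ⟨i, by omega⟩
    let b : Fin (m + 2 - 1) := ⟨i + 1, hi⟩
    have h1 : tau b (⟨i, by omega⟩ : Fin (m + 2)) = ⟨i, by omega⟩ :=
      Equiv.swap_apply_of_ne_of_ne (by simp [b, Fin.ext_iff])
        (by simp only [ne_eq, Fin.ext_iff, b]; omega)
    have h2 : tau b (⟨i + 1, by omega⟩ : Fin (m + 2)) = ⟨i + 2, by omega⟩ :=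
      Equiv.swap_apply_left _ _
    have h3 : tau a (⟨i, by omega⟩ : Fin (m + 2)) = ⟨i + 1, by omega⟩ :=
      Equiv.swap_apply_left _ _
    have h4 : tau a (⟨i + 2, by omega⟩ : Fin (m + 2)) = ⟨i + 2, by omega⟩ :=
      Equiv.swap_apply_of_ne_of_ne (by simp [a, Fin.ext_iff]) (by simp [a, Fin.ext_iff])
    have h5 := permBraid_conj_lam (tau a * tau b)
      (i := (⟨i, by omega⟩ : Fin (m + 2))) (j := ⟨i + 1, by omega⟩) (by simp [Fin.ext_iff])
    rw [← ih (by omega), Equiv.Perm.mul_apply, Equiv.Perm.mul_apply, h1, h2, h3, h4, map_mul,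
      permBraid_tau, permBraid_tau, mul_inv_eq_iff_eq_mul] at h5
    have h6 : pureGen b * (PresentedGroup.of (Gen.rho a) * PresentedGroup.of (Gen.rho b)) =
        PresentedGroup.of (Gen.rho a) * PresentedGroup.of (Gen.rho b) * pureGen a :=
      mixed_relation_conj (mk_eq_of_rel (Rel.M2 a b rfl)) (mk_eq_of_rel (Rel.P1 a b rfl))
    exact mul_right_cancel (h6.trans h5)

theorem exists_perm_extend {r n : ℕ} {v : Fin r → Fin n} (hv : Function.Injective v) :
    ∃ (h : r ≤ n) (g : Equiv.Perm (Fin n)), ∀ a, g (Fin.castLE h a) = v a := by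
  have h : r ≤ n := by simpa using Fintype.card_le_of_injective v hv
  obtain ⟨g, hg⟩ := Equiv.Perm.exists_extending_pair _ v (Fin.castLE_injective h) hv
  exact ⟨h, g, hg⟩

/-! ### Commutation of the generators -/

/-- With `s, t` for `σ_0, σ_1` and `p, q` for `ρ_0, ρ_1`, the three elements are `λ_01`, `λ_02` and
`λ_12`. The mixed relation eliminates `t`. Then F2 and F1 become the first two commutations, and the
braid relation becomes `λ_01 λ_02 λ_12 = λ_12 λ_02 λ_01`, from which `λ_02` cancels. -/
theorem mixed_relations_commute {G : Type*} [Group G] {s t p q : G} (hp : p * p = 1)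
    (hq : q * q = 1) (hpq : p * q * p = q * p * q) (h : p * q * s = t * p * q)
    (hf : p * t * s = t * s * q) (hf' : q * s * t = s * t * p) (hb : s * t * s = t * s * t) :
    Commute (s * p) (q * (s * p) * q⁻¹) ∧
      Commute (q * (s * p) * q⁻¹) (p * q * (s * p) * (p * q)⁻¹) ∧
      Commute (s * p) (p * q * (s * p) * (p * q)⁻¹) := by
  have hp' : p⁻¹ = p := inv_eq_of_mul_eq_one_right hp
  have hq' : q⁻¹ = q := inv_eq_of_mul_eq_one_right hq
  have hp1 : ∀ x, p * (p * x) = x := fun x => by rw [← mul_assoc, hp, one_mul]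
  have hq1 : ∀ x, q * (q * x) = x := fun x => by rw [← mul_assoc, hq, one_mul]
  have hpq0 : p * (q * p) = q * (p * q) := by simpa only [mul_assoc] using hpq
  have hpq1 : ∀ x, p * (q * (p * x)) = q * (p * (q * x)) := fun x => by
    simpa only [mul_assoc] using congrArg (· * x) hpq
  obtain rfl : t = p * q * s * q * p := by
    rw [h]
    simp only [mul_assoc, hp, hq, mul_one]
  have c1 : Commute (s * p) (q * (s * p) * q⁻¹) := by
    -- The virtual letters of the relation, moved to the right, form the longest element `q p q` of
    -- `S_3`.
    refine mul_right_cancel (b := q * p * q) ?_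
    simpa only [mul_inv_rev, hp', hq', mul_assoc, hp, hq, hp1, hq1, hpq0, hpq1, mul_one]
      using hf'.symm
  have c2 : Commute (q * (s * p) * q⁻¹) (p * q * (s * p) * (p * q)⁻¹) := by
    refine mul_right_cancel (b := q * p * q) ?_
    simpa only [mul_inv_rev, hp', hq', mul_assoc, hp, hq, hp1, hq1, hpq0, hpq1, mul_one]
      using hf
  refine ⟨c1, c2, ?_⟩
  set a := s * p with ha
  set b := p * q * a * (p * q)⁻¹ with hb'
  set c := q * a * q⁻¹ with hc'
  have h1 : a * c * b = b * c * a := by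
    refine mul_right_cancel (b := q * p * q) ?_
    simpa only [ha, hb', hc', mul_inv_rev, hp', hq', mul_assoc, hp, hq, hp1, hq1, hpq0, hpq1,
      mul_one] using hb
  have h2 : c * (a * b) = c * (b * a) := by
    calc c * (a * b) = a * c * b := by rw [c1.eq, mul_assoc c a b]
      _ = b * c * a := h1
      _ = c * (b * a) := by rw [← c2.eq, mul_assoc c b a]
  exact mul_left_cancel h2

theorem lam_commute_triangle {m : ℕ} {i j k : Fin (m + 2)} (hij : i ≠ j) (hik : i ≠ k)
    (hjk : j ≠ k) :
    Commute (lam i j) (lam i k) ∧ Commute (lam i k) (lam j k) ∧ Commute (lam i j) (lam j k) := by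
  obtain ⟨hm, g, hg⟩ := exists_perm_extend (v := ![i, j, k]) (by
    simp [Function.Injective, Fin.forall_fin_succ, hij, hik, hjk, hij.symm, hik.symm, hjk.symm])
  obtain ⟨m, rfl⟩ : ∃ m', m = m' + 1 := ⟨m - 1, by omega⟩
  have h0 : g 0 = i := hg 0
  have h1 : g 1 = j := hg 1
  have h2 : g ⟨2, by omega⟩ = k := hg 2
  rw [← h0, ← h1, ← h2]
  let i0 : Fin (m + 1 + 2 - 1) := ⟨0, by omega⟩
  let i1 : Fin (m + 1 + 2 - 1) := ⟨1, by omega⟩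
  have hB1 : (PresentedGroup.of (Gen.sigma i0) : UVB (m + 1 + 2)) *
      PresentedGroup.of (Gen.sigma i1) * PresentedGroup.of (Gen.sigma i0) =
      PresentedGroup.of (Gen.sigma i1) * PresentedGroup.of (Gen.sigma i0) *
      PresentedGroup.of (Gen.sigma i1) := mk_eq_of_rel (Rel.B1 i0 i1 rfl)
  have hrel := mixed_relations_commute (rho_mul_self i0) (rho_mul_self i1)
    (mk_eq_of_rel (Rel.P1 i0 i1 rfl)) (mk_eq_of_rel (Rel.M2 i0 i1 rfl))
    (mk_eq_of_rel (Rel.F1 i0 i1 rfl)) (mk_eq_of_rel (Rel.F2 i0 i1 rfl))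
    hB1
  rw [← permBraid_tau i0, ← permBraid_tau i1, ← map_mul] at hrel
  have hA : (PresentedGroup.of (Gen.sigma i0) : UVB (m + 1 + 2)) * permBraid _ (tau i0) =
      pureConj 1 := by
    rw [permBraid_tau, pureConj, map_one, inv_one, one_mul, mul_one]
    rfl
  rw [hA, permBraid_conj_pureConj, permBraid_conj_pureConj] at hrel
  have t1 : tau i1 (0 : Fin (m + 1 + 2)) = 0 :=
    Equiv.swap_apply_of_ne_of_ne (by simp [i1]) (by simp [i1])
  have t2 : tau i1 (1 : Fin (m + 1 + 2)) = ⟨2, by omega⟩ := Equiv.swap_apply_left _ _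
  have t3 : tau i0 (0 : Fin (m + 1 + 2)) = 1 := Equiv.swap_apply_left _ _
  have t4 : tau i0 (⟨2, by omega⟩ : Fin (m + 1 + 2)) = ⟨2, by omega⟩ :=
    Equiv.swap_apply_of_ne_of_ne (by simp [i0, Fin.ext_iff]) (by simp [i0, Fin.ext_iff])
  have e1 : permBraid _ g * pureConj 1 * (permBraid _ g)⁻¹ = lam (g 0) (g 1) := by
    rw [permBraid_conj_pureConj, pureConj_eq_lam, mul_one]
  have e2 : permBraid _ g * pureConj (tau i1 * 1) * (permBraid _ g)⁻¹ =
      lam (g 0) (g ⟨2, by omega⟩) := by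
    rw [permBraid_conj_pureConj, pureConj_eq_lam, mul_one, Equiv.Perm.mul_apply,
      Equiv.Perm.mul_apply, t1, t2]
  have e3 : permBraid _ g * pureConj (tau i0 * tau i1 * 1) * (permBraid _ g)⁻¹ =
      lam (g 1) (g ⟨2, by omega⟩) := by
    rw [permBraid_conj_pureConj, pureConj_eq_lam, mul_one, Equiv.Perm.mul_apply,
      Equiv.Perm.mul_apply, Equiv.Perm.mul_apply, Equiv.Perm.mul_apply, t1, t2, t3, t4]
  rw [← e1, ← e2, ← e3]
  exact ⟨(Commute.conj_iff _).2 hrel.1, (Commute.conj_iff _).2 hrel.2.1,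
    (Commute.conj_iff _).2 hrel.2.2⟩

/-- A simultaneous conjugation reduces this to `σ_0 ρ_0` and `σ_2 ρ_2`. -/
theorem lam_commute_disjoint {m : ℕ} {i j k l : Fin (m + 2)} (hij : i ≠ j) (hik : i ≠ k)
    (hil : i ≠ l) (hjk : j ≠ k) (hjl : j ≠ l) (hkl : k ≠ l) :
    Commute (lam i j) (lam k l) := by
  obtain ⟨hm, g, hg⟩ := exists_perm_extend (v := ![i, j, k, l]) (by
    simp [Function.Injective, Fin.forall_fin_succ, hij, hik, hil, hjk, hjl, hkl, hij.symm,
      hik.symm, hil.symm, hjk.symm, hjl.symm, hkl.symm])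
  have h0 : g ⟨0, by omega⟩ = i := hg 0
  have h1 : g ⟨1, by omega⟩ = j := hg 1
  have h2 : g ⟨2, by omega⟩ = k := hg 2
  have h3 : g ⟨3, by omega⟩ = l := hg 3
  rw [← h0, ← h1, ← h2, ← h3, ← permBraid_conj_lam g (by simp),
    ← permBraid_conj_lam g (by simp [Fin.ext_iff]), Commute.conj_iff,
    ← pureGen_eq_lam 0 (by omega), ← pureGen_eq_lam 2 (by omega)]
  exact commute_pureGen_pureGen (.inr le_rfl)

/-! ### Exchanging generators in closures -/

theorem commute_rho_last_addStrand {n : ℕ} (x : UVB n) (i : Fin (n + 2 - 1)) (hi : (i : ℕ) = n) :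
    Commute (PresentedGroup.of (Gen.rho i)) (addStrand (n + 1) (addStrand n x)) := by
  induction x using uvb_induction with
  | one => simp
  | of g =>
    rw [addStrand_of, addStrand_of]
    rcases g with ⟨j, hj⟩ | ⟨j, hj⟩
    · exact (mk_eq_of_rel (Rel.M1 (n := n + 2) ⟨j, by omega⟩ i
        (.inl (by simp only; omega)))).symm
    · exact (mk_eq_of_rel (Rel.P2 (n := n + 2) ⟨j, by omega⟩ i
        (.inl (by simp only; omega)))).symm
  | mul x y hx hy => simpa only [map_mul] using hx.mul_right hy
  | inv x hx => simpa only [map_inv] using hx.inv_right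

theorem addStrand_permBraid_swap {n : ℕ} (i j : Fin n) :
    addStrand n (permBraid n (Equiv.swap i j)) =
      permBraid (n + 1) (Equiv.swap i.castSucc j.castSucc) := by
  obtain ⟨h, hh, h1, h2⟩ := exists_addStrand_permBraid (Equiv.swap i j)
  rw [hh]
  congr 1
  ext k : 1
  induction k using Fin.lastCases with
  | last =>
    rw [h2, Equiv.swap_apply_of_ne_of_ne (Fin.castSucc_lt_last i).ne' (Fin.castSucc_lt_last j).ne']
  | cast k =>
    rw [h1, (Fin.castSucc_injective n).swap_apply]

/-- In the closure of a braid, `λ_{ij}` and `λ_{ji}` may be exchanged. -/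
theorem closureEquiv_lam_exchange {m : ℕ} {i j : Fin (m + 2)} (hij : i ≠ j) (z : UVB (m + 2)) :
    ClosureEquiv (lam i j * lam j i * z) (lam j i * lam i j * z) := by
  let e₁ := addStrand (m + 2)
  let e₂ := addStrand (m + 3)
  let i₁ : Fin (m + 1 + 2) := i.castSucc
  let j₁ : Fin (m + 1 + 2) := j.castSucc
  let u₁ : Fin (m + 1 + 2) := Fin.last (m + 2)
  let i₂ : Fin (m + 2 + 2) := i₁.castSucc
  let j₂ : Fin (m + 2 + 2) := j₁.castSucc
  let u₂ : Fin (m + 2 + 2) := u₁.castSucc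
  let v₂ : Fin (m + 2 + 2) := Fin.last (m + 3)
  have hij₁ : i₁ ≠ j₁ := fun h => hij (Fin.castSucc_injective _ h)
  have hiu₁ : i₁ ≠ u₁ := (Fin.castSucc_lt_last i).ne
  have hju₁ : j₁ ≠ u₁ := (Fin.castSucc_lt_last j).ne
  have hij₂ : i₂ ≠ j₂ := fun h => hij₁ (Fin.castSucc_injective _ h)
  have hiu₂ : i₂ ≠ u₂ := fun h => hiu₁ (Fin.castSucc_injective _ h)
  have hju₂ : j₂ ≠ u₂ := fun h => hju₁ (Fin.castSucc_injective _ h)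
  have hiv₂ : i₂ ≠ v₂ := (Fin.castSucc_lt_last i₁).ne
  have hjv₂ : j₂ ≠ v₂ := (Fin.castSucc_lt_last j₁).ne
  have huv₂ : u₂ ≠ v₂ := (Fin.castSucc_lt_last u₁).ne
  let P₁ := permBraid (m + 1 + 2)
  let P₂ := permBraid (m + 2 + 2)
  let c₁ := Equiv.swap i₁ u₁
  let c₂ := Equiv.swap i₂ u₂
  let d₁ := Equiv.swap j₁ u₁
  let d₂ := Equiv.swap j₂ v₂
  have hc : e₂ (P₁ c₁) = P₂ c₂ := addStrand_permBraid_swap i₁ u₁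
  -- cut the strand `i`
  have s1 : ClosureEquiv (lam j₁ u₁ * lam i₁ j₁ * P₁ c₁ * e₁ z) (lam i j * lam j i * z) := by
    have h := closureEquiv_cut (lam i j) (lam j i * z) i
    rw [map_mul, addStrand_lam hij, addStrand_lam hij.symm, ← mul_assoc (lam i j)] at h
    -- Passing the rerouting `c₁` turns `λ_ji` into `λ_ju`, which shares only `j` with `λ_ij` and so
    -- commutes with it.
    have h1 : lam i₁ j₁ * P₁ c₁ * (lam j₁ i₁ * e₁ z) =
        lam j₁ u₁ * lam i₁ j₁ * P₁ c₁ * e₁ z := by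
      rw [mul_assoc, ← mul_assoc (P₁ c₁), permBraid_mul_lam c₁ hij₁.symm,
        Equiv.swap_apply_of_ne_of_ne hij₁.symm hju₁, Equiv.swap_apply_left, ← mul_assoc,
        ← mul_assoc, (lam_commute_triangle hij₁ hiu₁ hju₁).2.2.eq]
    exact h1 ▸ h
  -- cut the strand `j`
  have s2 : ClosureEquiv (lam i₂ v₂ * P₂ c₂ * lam j₂ i₂ * P₂ d₂ * e₂ (e₁ z))
      (lam j₁ u₁ * lam i₁ j₁ * P₁ c₁ * e₁ z) := by
    have h := closureEquiv_cut (lam j₁ u₁) (lam i₁ j₁ * P₁ c₁ * e₁ z) j₁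
    rw [← mul_assoc (lam j₁ u₁), ← mul_assoc (lam j₁ u₁)] at h
    -- Passing `d₂` turns `λ_ij` into `λ_iv`, which is disjoint from `λ_ju`. After the exchange of
    -- these two, `λ_ju` passes `c₂` and becomes `λ_ji` again.
    have h1 : e₂ (lam j₁ u₁) * P₂ d₂ * e₂ (lam i₁ j₁ * P₁ c₁ * e₁ z) =
        lam i₂ v₂ * P₂ c₂ * lam j₂ i₂ * P₂ d₂ * e₂ (e₁ z) := by
      have hcd : c₂ * d₂ = d₂ * c₂ := by
        have c_j : c₂ j₂ = j₂ := Equiv.swap_apply_of_ne_of_ne hij₂.symm hju₂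
        have c_v : c₂ v₂ = v₂ := Equiv.swap_apply_of_ne_of_ne hiv₂.symm huv₂.symm
        rw [Equiv.mul_swap_eq_swap_mul, c_j, c_v]
      have hA : P₂ d₂ * lam i₂ j₂ = lam i₂ v₂ * P₂ d₂ := by
        rw [permBraid_mul_lam d₂ hij₂, Equiv.swap_apply_of_ne_of_ne hij₂ hiv₂,
          Equiv.swap_apply_left]
      have hB : P₂ c₂ * lam j₂ i₂ = lam j₂ u₂ * P₂ c₂ := by
        rw [permBraid_mul_lam c₂ hij₂.symm, Equiv.swap_apply_of_ne_of_ne hij₂.symm hju₂,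
          Equiv.swap_apply_left]
      have hAB : lam i₂ v₂ * lam j₂ u₂ = lam j₂ u₂ * lam i₂ v₂ :=
        lam_commute_disjoint hiv₂ hij₂ hiu₂ hjv₂.symm huv₂.symm hju₂
      rw [map_mul, map_mul, hc, addStrand_lam hju₁, addStrand_lam hij₁]
      calc lam j₂ u₂ * P₂ d₂ * (lam i₂ j₂ * P₂ c₂ * e₂ (e₁ z))
          = lam j₂ u₂ * (P₂ d₂ * lam i₂ j₂) * P₂ c₂ * e₂ (e₁ z) := by simp only [mul_assoc]
        _ = lam j₂ u₂ * lam i₂ v₂ * P₂ (d₂ * c₂) * e₂ (e₁ z) := by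
          rw [hA, map_mul]; simp only [mul_assoc]
        _ = lam i₂ v₂ * (lam j₂ u₂ * P₂ c₂) * P₂ d₂ * e₂ (e₁ z) := by
          rw [← hAB, ← hcd, map_mul]; simp only [mul_assoc]
        _ = _ := by rw [← hB]; simp only [mul_assoc]
    exact h1 ▸ h
  -- join the strand `i`
  have s3 : ClosureEquiv (lam i₂ v₂ * P₂ c₂ * lam j₂ i₂ * P₂ d₂ * e₂ (e₁ z))
      (lam i₁ u₁ * (lam j₁ i₁ * P₁ d₁ * e₁ z)) := by
    have hd : e₂ (P₁ d₁) = P₂ (Equiv.swap j₂ u₂) := addStrand_permBraid_swap j₁ u₁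
    have h := closureEquiv_cut (lam i₁ u₁) (lam j₁ i₁ * P₁ d₁ * e₁ z) i₁
    have hz : P₂ (Equiv.swap u₂ v₂) * e₂ (e₁ z) = e₂ (e₁ z) * P₂ (Equiv.swap u₂ v₂) := by
      have h1 := commute_rho_last_addStrand z (Fin.last (m + 2)) rfl
      rw [← permBraid_tau] at h1
      exact h1
    -- Only the last strand can be removed. Conjugation by `f` exchanges the two new strands and
    -- leaves `z` fixed, so that strand `i` is rerouted through the last one.
    set f := Equiv.swap u₂ v₂ with hf
    have f_i : f i₂ = i₂ := Equiv.swap_apply_of_ne_of_ne hiu₂ hiv₂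
    have f_j : f j₂ = j₂ := Equiv.swap_apply_of_ne_of_ne hju₂ hjv₂
    have f_u : f u₂ = v₂ := Equiv.swap_apply_left _ _
    have f_v : f v₂ = u₂ := Equiv.swap_apply_right _ _
    have hfA : P₂ f * lam i₂ v₂ = lam i₂ u₂ * P₂ f := by
      rw [permBraid_mul_lam f hiv₂, f_i, f_v]
    have hfB : P₂ f * lam j₂ i₂ = lam j₂ i₂ * P₂ f := by
      rw [permBraid_mul_lam f hij₂.symm, f_i, f_j]
    have hfc : P₂ f * P₂ c₂ = P₂ (Equiv.swap i₂ v₂) * P₂ f := by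
      rw [← map_mul, ← map_mul, Equiv.mul_swap_eq_swap_mul, f_i, f_u]
    have hfd : P₂ f * P₂ d₂ = P₂ (Equiv.swap j₂ u₂) * P₂ f := by
      rw [← map_mul, ← map_mul, Equiv.mul_swap_eq_swap_mul, f_j, f_v]
    have h1 : e₂ (lam i₁ u₁) * P₂ (Equiv.swap i₂ v₂) * e₂ (lam j₁ i₁ * P₁ d₁ * e₁ z) =
        P₂ f * (lam i₂ v₂ * P₂ c₂ * lam j₂ i₂ * P₂ d₂ * e₂ (e₁ z)) * (P₂ f)⁻¹ := by
      rw [map_mul, map_mul, hd, addStrand_lam hiu₁, addStrand_lam hij₁.symm,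
        eq_mul_inv_iff_mul_eq]
      calc lam i₂ u₂ * P₂ (Equiv.swap i₂ v₂) *
            (lam j₂ i₂ * P₂ (Equiv.swap j₂ u₂) * e₂ (e₁ z)) * P₂ f
          = lam i₂ u₂ * P₂ (Equiv.swap i₂ v₂) * lam j₂ i₂ * P₂ (Equiv.swap j₂ u₂) *
              (e₂ (e₁ z) * P₂ f) := by simp only [mul_assoc]
        _ = lam i₂ u₂ * P₂ (Equiv.swap i₂ v₂) * lam j₂ i₂ * (P₂ (Equiv.swap j₂ u₂) * P₂ f) *
              e₂ (e₁ z) := by rw [← hz]; simp only [mul_assoc]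
        _ = lam i₂ u₂ * P₂ (Equiv.swap i₂ v₂) * (lam j₂ i₂ * P₂ f) * P₂ d₂ *
              e₂ (e₁ z) := by rw [← hfd]; simp only [mul_assoc]
        _ = lam i₂ u₂ * (P₂ (Equiv.swap i₂ v₂) * P₂ f) * lam j₂ i₂ * P₂ d₂ *
              e₂ (e₁ z) := by rw [← hfB]; simp only [mul_assoc]
        _ = lam i₂ u₂ * P₂ f * P₂ c₂ * lam j₂ i₂ * P₂ d₂ * e₂ (e₁ z) := by
          rw [← hfc]; simp only [mul_assoc]
        _ = _ := by rw [← hfA]; simp only [mul_assoc]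
    have h2 : ClosureEquiv
        (P₂ f * (lam i₂ v₂ * P₂ c₂ * lam j₂ i₂ * P₂ d₂ * e₂ (e₁ z)) * (P₂ f)⁻¹)
        (lam i₁ u₁ * (lam j₁ i₁ * P₁ d₁ * e₁ z)) := h1 ▸ h
    exact (ClosureEquiv.conj _ _).symm.trans h2
  -- join the strand `j`
  have s4 : ClosureEquiv (lam i₁ u₁ * (lam j₁ i₁ * P₁ d₁ * e₁ z)) (lam j i * lam i j * z) := by
    have h := closureEquiv_cut (lam j i) (lam i j * z) j
    rw [map_mul, addStrand_lam hij, addStrand_lam hij.symm, ← mul_assoc (lam j i)] at h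
    have h1 : lam j₁ i₁ * P₁ d₁ * (lam i₁ j₁ * e₁ z) =
        lam i₁ u₁ * (lam j₁ i₁ * P₁ d₁ * e₁ z) := by
      rw [mul_assoc, ← mul_assoc (P₁ d₁), permBraid_mul_lam d₁ hij₁,
        Equiv.swap_apply_of_ne_of_ne hij₁ hiu₁, Equiv.swap_apply_left, ← mul_assoc,
        ← mul_assoc, (lam_commute_triangle hij₁.symm hju₁ hiu₁).2.2.eq]
      simp only [P₁, mul_assoc]
    exact h1 ▸ h
  exact s1.symm.trans (s2.symm.trans (s3.trans s4))

open scoped commutatorElement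

/-! ### Closures of pure braids -/

/-- The braids that may be inserted anywhere without changing the closure. -/
def closureKernel (n : ℕ) : Subgroup (UVB n) where
  carrier := {c | ∀ z, ClosureEquiv (c * z) z}
  one_mem' z := .of_eq (one_mul z)
  mul_mem' {c d} hc hd z := by
    rw [mul_assoc]
    exact (hc _).trans (hd z)
  inv_mem' {c} hc z := by
    have h := (hc (c⁻¹ * z)).symm
    rwa [mul_inv_cancel_left] at h

/-- By cyclic invariance, `g c g⁻¹ z` closes like `c g⁻¹ z g`, where `c` can be dropped; what
remains is a conjugate of `z`. -/
theorem closureKernel_normal (n : ℕ) : (closureKernel n).Normal where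
  conj_mem c hc g z := by
    have h1 := ClosureEquiv.mul_comm g (c * g⁻¹ * z)
    have h2 := hc (g⁻¹ * z * g)
    have h3 := ClosureEquiv.mul_comm (g⁻¹ * z) g
    simp only [mul_assoc, mul_inv_cancel_left] at h1 h2 h3 ⊢
    exact h1.trans (h2.trans h3)

theorem commutator_mem_closureKernel {n : ℕ} {a b : UVB n}
    (h : ∀ z, ClosureEquiv (a * b * z) (b * a * z)) : ⁅a, b⁆ ∈ closureKernel n := by
  intro z
  have h1 := h (a⁻¹ * b⁻¹ * z)
  have h2 : a * b * (a⁻¹ * b⁻¹ * z) = ⁅a, b⁆ * z := by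
    rw [commutatorElement_def]
    group
  have h3 : b * a * (a⁻¹ * b⁻¹ * z) = z := by group
  rwa [h2, h3] at h1

theorem commutator_lam_mem_closureKernel {m : ℕ} {i j k l : Fin (m + 2)} (hij : i ≠ j)
    (hkl : k ≠ l) : ⁅lam i j, lam k l⁆ ∈ closureKernel (m + 2) := by
  have key : Commute (lam i j) (lam k l) → ⁅lam i j, lam k l⁆ ∈ closureKernel (m + 2) := by
    intro h
    rw [commutatorElement_eq_one_iff_commute.2 h]
    exact one_mem _
  by_cases hik : i = k
  · subst hik
    by_cases hjl : j = l
    · subst hjl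
      exact key (Commute.refl _)
    · exact key (lam_commute_triangle hij hkl hjl).1
  by_cases hjl : j = l
  · subst hjl
    exact key (lam_commute_triangle hik hij hkl).2.1
  by_cases hjk : j = k
  · subst hjk
    by_cases hil : i = l
    · subst hil
      exact commutator_mem_closureKernel (closureEquiv_lam_exchange hij)
    · exact key (lam_commute_triangle hij hil hjl).2.2
  by_cases hil : i = l
  · subst hil
    exact key (lam_commute_triangle hkl (Ne.symm hjk) hij).2.2.symm
  exact key (lam_commute_disjoint hij hik hil hjk hjl hkl)

/-- The subgroup generated by the `λ_{ij}`. -/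
def lamSubgroup (m : ℕ) : Subgroup (UVB (m + 2)) := Subgroup.closure (Set.range pureConj)

theorem permBraid_conj_mem_lamSubgroup {m : ℕ} (g : Equiv.Perm (Fin (m + 2)))
    {x : UVB (m + 2)} (hx : x ∈ lamSubgroup m) :
    permBraid (m + 2) g * x * (permBraid (m + 2) g)⁻¹ ∈ lamSubgroup m := by
  have h : (lamSubgroup m).map (MulAut.conj (permBraid (m + 2) g)).toMonoidHom ≤
      lamSubgroup m := by
    rw [lamSubgroup, MonoidHom.map_closure, Subgroup.closure_le]
    rintro _ ⟨_, ⟨f, rfl⟩, rfl⟩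
    exact Subgroup.subset_closure ⟨g * f, (permBraid_conj_pureConj g f).symm⟩
  exact h ⟨x, hx, rfl⟩

/-- Every braid is a product of `λ`'s times a permutation, since permutations normalize the subgroup
of the `λ`'s. On pure braids the permutation is trivial, so the `λ`'s generate `UVP_n`. -/
theorem mul_permBraid_inv_mem_lamSubgroup {m : ℕ} (x : UVB (m + 2)) :
    x * (permBraid (m + 2) (iota (m + 2) x))⁻¹ ∈ lamSubgroup m := by
  induction x using uvb_induction with
  | one => simp
  | of g =>
    rcases g with i | i
    · have h : pureGen i ∈ lamSubgroup m :=
        Subgroup.subset_closure ⟨_, (pureGen_eq_lam (m := m) i.1 i.2).symm⟩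
      rw [iota_of, genPerm, permBraid_tau, inv_eq_of_mul_eq_one_right (rho_mul_self i)]
      exact h
    · rw [iota_of, genPerm, permBraid_tau, mul_inv_cancel]
      exact one_mem _
  | mul x y hx hy =>
    have h := mul_mem hx (permBraid_conj_mem_lamSubgroup (iota (m + 2) x) hy)
    convert h using 1
    simp only [map_mul]
    group
  | inv x hx =>
    have h := permBraid_conj_mem_lamSubgroup (iota (m + 2) x)⁻¹ (inv_mem hx)
    convert h using 1
    simp only [map_inv]
    group

theorem UVP_le_lamSubgroup (m : ℕ) : UVP (m + 2) ≤ lamSubgroup m := by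
  intro x hx
  have h := mul_permBraid_inv_mem_lamSubgroup x
  rwa [show iota (m + 2) x = 1 from hx, map_one, inv_one, mul_one] at h

theorem commutator_UVP_le (m : ℕ) : ⁅UVP (m + 2), UVP (m + 2)⁆ ≤ closureKernel (m + 2) := by
  have := closureKernel_normal (m + 2)
  refine (Subgroup.commutator_mono (UVP_le_lamSubgroup m) (UVP_le_lamSubgroup m)).trans ?_
  rw [Subgroup.commutator_le]
  intro x hx y hy
  -- Modulo the normal subgroup the condition is that images commute, which extends from generators
  -- to products and inverses.
  have hcomm : ∀ {x y : UVB (m + 2)}, ⁅x, y⁆ ∈ closureKernel (m + 2) ↔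
      Commute (QuotientGroup.mk' (closureKernel (m + 2)) x)
        (QuotientGroup.mk' (closureKernel (m + 2)) y) := by
    intro x y
    rw [← commutatorElement_eq_one_iff_commute, ← map_commutatorElement,
      QuotientGroup.mk'_apply, QuotientGroup.eq_one_iff]
  rw [hcomm]
  induction hx, hy using Subgroup.closure_induction₂ with
  | mem x y hx hy =>
    obtain ⟨f, rfl⟩ := hx
    obtain ⟨g, rfl⟩ := hy
    rw [← hcomm, pureConj_eq_lam, pureConj_eq_lam]
    exact commutator_lam_mem_closureKernel (f.injective.ne zero_ne_one)
      (g.injective.ne zero_ne_one)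
  | one_left => simp
  | one_right => simp
  | mul_left x y z _ _ _ h1 h2 => rw [map_mul]; exact h1.mul_left h2
  | mul_right x y z _ _ _ h1 h2 => rw [map_mul]; exact h1.mul_right h2
  | inv_left x y _ _ h => rw [map_inv]; exact h.inv_left
  | inv_right x y _ _ h => rw [map_inv]; exact h.inv_right

/-- Up to equivalence, the closure of a pure braid only depends on its class in the
abelianization. -/
theorem closureEquiv_of_abelianization_eq {m : ℕ} {a b : UVP (m + 2)}
    (h : Abelianization.of a = Abelianization.of b) :
    ClosureEquiv (a : UVB (m + 2)) (b : UVB (m + 2)) := by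
  have h1 : a * b⁻¹ ∈ commutator (UVP (m + 2)) := by
    rw [← Abelianization.ker_of, MonoidHom.mem_ker, map_mul, map_inv, h, mul_inv_cancel]
  have h2 : (commutator (UVP (m + 2))).map (UVP (m + 2)).subtype ≤ closureKernel (m + 2) := by
    rw [commutator_def, Subgroup.map_commutator]
    refine (Subgroup.commutator_mono ?_ ?_).trans (commutator_UVP_le m) <;>
      exact Subgroup.map_subtype_le _
  have h3 := h2 ⟨_, h1, rfl⟩ (b : UVB (m + 2))
  simpa using h3

theorem subsingleton_UVB {n : ℕ} (hn : n < 2) : Subsingleton (UVB n) := by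
  refine ⟨fun x y => ?_⟩
  have h : ∀ x : UVB n, x = 1 := by
    intro x
    induction x using uvb_induction with
    | one => rfl
    | of g => rcases g with ⟨i, hi⟩ | ⟨i, hi⟩ <;> omega
    | mul x y hx hy => rw [hx, hy, mul_one]
    | inv x hx => rw [hx, inv_one]
  rw [h x, h y]

end FusedLinks

theorem mainTheorem3 (n : ℕ) (α β : FusedLinks.UVP n)
    (a b : FusedLinks.UVP n)
    (ha : Abelianization.of a = Abelianization.of α)
    (hb : Abelianization.of b = Abelianization.of β)
    (μ : FusedLinks.UVB n) (hμ : μ ∈ FusedLinks.symmSubgroup n)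
    (hconj : (b : FusedLinks.UVB n) = μ⁻¹ * (a : FusedLinks.UVB n) * μ)
    (D E : FusedLinks.Diagram)
    (hD : FusedLinks.IsClosure (α : FusedLinks.UVB n) D)
    (hE : FusedLinks.IsClosure (β : FusedLinks.UVB n) E) :
    D.Equivalent E := by
  rcases Nat.lt_or_ge n 2 with hn | hn
  -- The `λ_ij` need two strands; with fewer there are no generators.
  · have := FusedLinks.subsingleton_UVB hn
    exact FusedLinks.ClosureEquiv.of_eq
      (Subsingleton.elim (α : FusedLinks.UVB n) (β : FusedLinks.UVB n)) D E hD hE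
  · obtain ⟨m, rfl⟩ : ∃ m, n = m + 2 := ⟨n - 2, by omega⟩
    have h := FusedLinks.ClosureEquiv.conj μ⁻¹ (a : FusedLinks.UVB (m + 2))
    rw [inv_inv, ← hconj] at h
    exact ((FusedLinks.closureEquiv_of_abelianization_eq ha).symm.trans
      (h.symm.trans (FusedLinks.closureEquiv_of_abelianization_eq hb))) D E hD hE
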